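/- Let $\mathbf{Top}$ be a locally presentable, cartesian closed full subcategory of the category of topological spaces which contains the disks $\mathbf{D}^n=\{b\in\mathbb{R}^n : |b|\le 1\}$ and the spheres $\mathbf{S}^{n-1}=\{b\in\mathbb{R}^n : |b|=1\}$ for all $n\ge 0$ (with $\mathbf{D}^0$ a point and $\mathbf{S}^{-1}=\varnothing$); for instance the $\Delta$-generated spaces, or the $\Delta$-Hausdorff $\Delta$-generated spaces. A flow is a small semicategory (category without identities) enriched over $(\mathbf{Top},\times)$; $\mathbf{Flow}$ is the category of flows and enriched semifunctors, and $\mathbf{Cat}$ is the category of small categories enriched over $(\mathbf{Top},\times)$ and enriched functors. Let $\mathbb{I}:\mathbf{Flow}\to\mathbf{Cat}$ be the left adjoint of the functor forgetting that identities exist: $\mathbb{I}$ adds to each state an identity map as an isolated point. A set is viewed as a flow without execution paths. For a space $Z$, let $\mathrm{Glob}(Z)$ be the flow with two states $0,1$, with $Z$ as the space of execution paths from $0$ to $1$, and with no other execution path. Let $$I^{gl}=\{\mathrm{Glob}(\mathbf{S}^{n-1})\subset \mathrm{Glob}(\mathbf{D}^{n}) \mid n\ge 0\},\qquad C:\varnothing\to\{0\}.$$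 For a class of maps $\mathcal{S}$, let $\mathrm{inj}(\mathcal{S})$ be the class of maps with the right lifting property with respect to $\mathcal{S}$, and $\mathrm{cof}(\mathcal{S})$ the class of maps with the left lifting property with respect to $\mathrm{inj}(\mathcal{S})$. Let $\mathcal{C}_{DK}=\mathrm{cof}(\mathbb{I}(I^{gl}\cup\{C\}))$ be the class of cofibrations of the Ilias model structure on $\mathbf{Cat}$, whose trivial fibrations form the class $\mathrm{inj}(\mathcal{C}_{DK})$. Then the left-lifting along $\mathbb{I}$ of the weak factorization system (cofibrations, trivial fibrations) of the Ilias model structure, i.e. the weak factorization system on $\mathbf{Flow}$ with left class $\mathbb{I}^{-1}(\mathcal{C}_{DK})$, exists and is small, being generated by the set $I^{gl}\cup\{C\}$. That is, $\mathbb{I}^{-1}(\mathcal{C}_{DK})=\mathrm{cof}(I^{gl}\cup\{C\})$, and $(\mathrm{cof}(I^{gl}\cup\{C\}),\mathrm{inj}(I^{gl}\cup\{C\}))$ is a weak factorization system on $\mathbf{Flow}$. -/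

import Mathlib

open CategoryTheory Limits MonoidalCategory CartesianMonoidalCategory

universe w v u

noncomputable section

/-! ### Small semicategories and small categories enriched over `(V, ×)` -/

/-- A small semicategory (category without identities) enriched over a cartesian monoidal
category `V`. For `V` a convenient category of spaces this is a *flow*: `Obj` is the set of
states and `Path a b` is the space of execution paths from `a` to `b`. -/
structure EnrSemicat (V : Type u) [Category.{v} V] [CartesianMonoidalCategory V] where
  /-- The set of states. -/
  Obj : Type w
  /-- The space of execution paths from `a` to `b`. -/
  Path : Obj → Obj → V
  /-- The composition `x * y` of an execution path `x` followed by `y`. -/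
  comp (a b c : Obj) : Path a b ⊗ Path b c ⟶ Path a c
  assoc (a b c d : Obj) :
    comp a b c ▷ Path c d ≫ comp a c d =
      (α_ (Path a b) (Path b c) (Path c d)).hom ≫ Path a b ◁ comp b c d ≫ comp a b d

/-- A map of flows: an enriched semifunctor. -/
structure EnrSemifunctor {V : Type u} [Category.{v} V] [CartesianMonoidalCategory V]
    (X Y : EnrSemicat.{w} V) where
  /-- The map on states. -/
  obj : X.Obj → Y.Obj
  /-- The map on execution paths. -/
  map (a b : X.Obj) : X.Path a b ⟶ Y.Path (obj a) (obj b)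
  map_comp (a b c : X.Obj) :
    X.comp a b c ≫ map a c = (map a b ⊗ₘ map b c) ≫ Y.comp (obj a) (obj b) (obj c)

instance EnrSemicat.category (V : Type u) [Category.{v} V] [CartesianMonoidalCategory V] :
    Category (EnrSemicat.{w} V) where
  Hom X Y := EnrSemifunctor X Y
  id X := { obj := fun a => a, map := fun _ _ => 𝟙 _, map_comp := by simp }
  comp f g :=
    { obj := fun a => g.obj (f.obj a)
      map := fun a b => f.map a b ≫ g.map (f.obj a) (f.obj b)
      map_comp := by
        intro a b c
        rw [← Category.assoc, f.map_comp, Category.assoc, g.map_comp, ← Category.assoc,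
          ← MonoidalCategory.tensorHom_comp_tensorHom] }
  id_comp f := by cases f; simp
  comp_id f := by cases f; simp
  assoc f g h := by simp

/-- A small category enriched over `V`. -/
structure EnrCat (V : Type u) [Category.{v} V] [CartesianMonoidalCategory V] where
  /-- The set of objects. -/
  Obj : Type w
  /-- The enrichment. -/
  [str : EnrichedCategory V Obj]

attribute [instance] EnrCat.str

/-- The category of small categories enriched over `V`, the maps being the enriched functors. -/
instance EnrCat.category (V : Type u) [Category.{v} V] [CartesianMonoidalCategory V] :
    Category (EnrCat.{w} V) where
  Hom X Y := EnrichedFunctor V X.Obj Y.Obj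
  id X := EnrichedFunctor.id V X.Obj
  comp f g := EnrichedFunctor.comp V f g
  id_comp f := by cases f; simp [EnrichedFunctor.id, EnrichedFunctor.comp]
  comp_id f := by cases f; simp [EnrichedFunctor.id, EnrichedFunctor.comp]
  assoc f g h := by simp [EnrichedFunctor.comp]

theorem enrichedFunctor_ext {V : Type u} [Category.{v} V] [MonoidalCategory V] {C D : Type w}
    [EnrichedCategory V C] [EnrichedCategory V D] {F G : EnrichedFunctor V C D}
    (h₁ : F.obj = G.obj) (h₂ : HEq F.map G.map) : F = G := by
  cases F
  cases G
  cases h₁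
  cases h₂
  rfl

section Closed

variable {V : Type u} [Category.{v} V] [CartesianMonoidalCategory V] [MonoidalClosed V]

/-! ### Products with an initial object -/

/-- In a cartesian closed category, `A × B` is initial if `B` is. -/
def tensorRightInitial {A B : V} (t : IsInitial B) : IsInitial (A ⊗ B) :=
  t.ofIso (zeroMul t).symm

/-- In a cartesian closed category, `A × B` is initial if `A` is. -/
def tensorLeftInitial {A B : V} (t : IsInitial A) : IsInitial (A ⊗ B) :=
  (tensorRightInitial t : IsInitial (B ⊗ A)).ofIso
    { hom := lift (snd B A) (fst B A), inv := lift (snd A B) (fst A B) }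

variable [HasColimitsOfSize.{v, v} V]

/-! ### Sets and globes as flows -/

/-- `Z` if the proposition `p` holds, the initial object otherwise. -/
def copow (p : Prop) (Z : V) : V := ∐ fun _ : ULift.{v} (PLift p) => Z

/-- The canonical map `Z ⟶ copow p Z` (an isomorphism) if `p` holds. -/
def copow.ι {p : Prop} (h : p) (Z : V) : Z ⟶ copow p Z :=
  Sigma.ι (fun _ : ULift.{v} (PLift p) => Z) ⟨⟨h⟩⟩

/-- The map out of `copow p Z` given by a map out of `Z` in case `p` holds. -/
def copow.desc {p : Prop} {Z W : V} (f : p → (Z ⟶ W)) : copow p Z ⟶ W :=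
  Sigma.desc fun h : ULift.{v} (PLift p) => f h.down.down

theorem copow.ι_desc {p : Prop} {Z W : V} (f : p → (Z ⟶ W)) (h : p) :
    copow.ι h Z ≫ copow.desc f = f h := by
  exact Sigma.ι_desc (fun h : ULift.{v} (PLift p) => f h.down.down) ⟨⟨h⟩⟩

theorem copow.hom_ext {p : Prop} {Z W : V} {f g : copow p Z ⟶ W}
    (H : ∀ h : p, copow.ι h Z ≫ f = copow.ι h Z ≫ g) : f = g :=
  Sigma.hom_ext _ _ fun h => H h.down.down

/-- `copow p Z` is initial if `p` does not hold. -/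
def copow.isInitial {p : Prop} (h : ¬ p) (Z : V) : IsInitial (copow p Z) :=
  IsInitial.ofUniqueHom (fun _ => copow.desc fun hp => absurd hp h)
    fun _ _ => copow.hom_ext fun hp => absurd hp h

open Classical in
/-- `copow p Y × copow q Z` is initial if `p` and `q` exclude each other. -/
def copow.tensorIsInitial {p q : Prop} (h : ¬ (p ∧ q)) (Y Z : V) :
    IsInitial (copow p Y ⊗ copow q Z) :=
  if hp : p then tensorRightInitial (copow.isInitial (fun hq => h ⟨hp, hq⟩) Z)
  else tensorLeftInitial (copow.isInitial hp Y)

/-- A set viewed as a flow with an empty space of execution paths. -/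
def setFlow (V : Type u) [Category.{v} V] [CartesianMonoidalCategory V] [MonoidalClosed V]
    [HasColimitsOfSize.{v, v} V] (A : Type w) : EnrSemicat.{w} V where
  Obj := A
  Path _ _ := ⊥_ V
  comp _ _ _ := (tensorRightInitial initialIsInitial).to _
  assoc _ _ _ _ := (tensorRightInitial initialIsInitial).hom_ext _ _

/-- A map of sets viewed as a map of flows. -/
def setFlowMap (V : Type u) [Category.{v} V] [CartesianMonoidalCategory V] [MonoidalClosed V]
    [HasColimitsOfSize.{v, v} V] {A B : Type w} (f : A → B) : setFlow V A ⟶ setFlow V B where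
  obj := f
  map _ _ := 𝟙 _
  map_comp _ _ _ := (tensorRightInitial initialIsInitial).hom_ext _ _

theorem glob_excl (a b c : ULift.{w} (Fin 2)) :
    ¬ ((a.down = 0 ∧ b.down = 1) ∧ (b.down = 0 ∧ c.down = 1)) := by
  rintro ⟨⟨_, h⟩, ⟨h', _⟩⟩
  rw [h] at h'
  exact absurd h' (by decide)

/-- The globe `Glob(Z)`: two states `0` and `1`, the space `Z` as space of execution paths from
`0` to `1`, and no other execution path (hence no composition law). -/
def Glob (Z : V) : EnrSemicat.{w} V where
  Obj := ULift.{w} (Fin 2)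
  Path a b := copow (a.down = 0 ∧ b.down = 1) Z
  comp a b c := (copow.tensorIsInitial (glob_excl a b c) Z Z).to _
  assoc a b c _ := (tensorLeftInitial (copow.tensorIsInitial (glob_excl a b c) Z Z)).hom_ext _ _

/-- The map of flows `Glob(Y) ⟶ Glob(Z)` induced by a map `Y ⟶ Z`. -/
def Glob.map {Y Z : V} (f : Y ⟶ Z) : (Glob Y : EnrSemicat.{w} V) ⟶ Glob Z where
  obj a := a
  map _ _ := copow.desc fun h => f ≫ copow.ι h Z
  map_comp a b c := (copow.tensorIsInitial (glob_excl a b c) Y Y).hom_ext _ _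

/-! ### Adding identities to a flow -/

/-- The space of morphisms from `a` to `b` after adding identities: the coproduct of
`Path a b` with a point (the identity of `a`) if `a = b`, and `Path a b` otherwise. -/
def EnrSemicat.IdHom (X : EnrSemicat.{w} V) (a b : X.Obj) : V := copow (a = b) (𝟙_ V) ⨿ X.Path a b

namespace EnrSemicat

variable (X : EnrSemicat.{w} V)

/-- The added identity of `a`, seen from `a` to `b` if `a = b`. -/
def idι {a b : X.Obj} (h : a = b) : 𝟙_ V ⟶ X.IdHom a b := copow.ι h _ ≫ coprod.inl

/-- The inclusion of the execution paths. -/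
def pathι (a b : X.Obj) : X.Path a b ⟶ X.IdHom a b := coprod.inr

variable {X}

/-- Maps out of `IdHom a b`. -/
def idDesc {a b : X.Obj} {W : V} (f : a = b → (𝟙_ V ⟶ W)) (g : X.Path a b ⟶ W) :
    X.IdHom a b ⟶ W := coprod.desc (copow.desc f) g

theorem idι_idDesc {a b : X.Obj} {W : V} (f : a = b → (𝟙_ V ⟶ W)) (g : X.Path a b ⟶ W)
    (h : a = b) : X.idι h ≫ idDesc f g = f h := by
  exact (Category.assoc _ _ _).trans
    ((congrArg (copow.ι h _ ≫ ·) (coprod.inl_desc _ _)).trans (copow.ι_desc f h))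

theorem pathι_idDesc {a b : X.Obj} {W : V} (f : a = b → (𝟙_ V ⟶ W)) (g : X.Path a b ⟶ W) :
    X.pathι a b ≫ idDesc f g = g :=
  coprod.inr_desc _ _

theorem id_hom_ext {a b : X.Obj} {W : V} {f g : X.IdHom a b ⟶ W}
    (h₁ : ∀ h : a = b, X.idι h ≫ f = X.idι h ≫ g)
    (h₂ : X.pathι a b ≫ f = X.pathι a b ≫ g) : f = g :=
  coprod.hom_ext (copow.hom_ext fun h =>
    (Category.assoc _ _ _).symm.trans ((h₁ h).trans (Category.assoc _ _ _))) h₂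

/-- Maps out of `A × IdHom a b`. -/
def idDescRight {a b : X.Obj} {A W : V} (f : a = b → (A ⟶ W)) (g : A ⊗ X.Path a b ⟶ W) :
    A ⊗ X.IdHom a b ⟶ W :=
  MonoidalClosed.uncurry
    (idDesc (fun h => MonoidalClosed.curry (fst A (𝟙_ V) ≫ f h)) (MonoidalClosed.curry g))

/-- Maps out of `IdHom a b × A`. -/
def idDescLeft {a b : X.Obj} {A W : V} (f : a = b → (A ⟶ W)) (g : X.Path a b ⊗ A ⟶ W) :
    X.IdHom a b ⊗ A ⟶ W :=
  lift (snd _ _) (fst _ _) ≫ idDescRight f (lift (snd _ _) (fst _ _) ≫ g)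

theorem idι_idDescRight {a b : X.Obj} {A W : V} (f : a = b → (A ⟶ W))
    (g : A ⊗ X.Path a b ⟶ W) (h : a = b) :
    A ◁ X.idι h ≫ idDescRight f g = fst _ _ ≫ f h := by
  rw [idDescRight, ← MonoidalClosed.uncurry_natural_left, idι_idDesc,
    MonoidalClosed.uncurry_curry]

theorem pathι_idDescRight {a b : X.Obj} {A W : V} (f : a = b → (A ⟶ W))
    (g : A ⊗ X.Path a b ⟶ W) : A ◁ X.pathι a b ≫ idDescRight f g = g := by
  rw [idDescRight, ← MonoidalClosed.uncurry_natural_left, pathι_idDesc,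
    MonoidalClosed.uncurry_curry]

theorem swap_whisker {A B C : V} (f : B ⟶ C) :
    f ▷ A ≫ lift (snd C A) (fst C A) = lift (snd B A) (fst B A) ≫ A ◁ f := by
  ext <;> simp

theorem swap_whiskerLeft {A B C W : V} (f : B ⟶ C) (g : C ⊗ A ⟶ W) :
    A ◁ f ≫ lift (snd A C) (fst A C) ≫ g = lift (snd A B) (fst A B) ≫ f ▷ A ≫ g := by
  simp only [← Category.assoc]
  congr 1
  ext <;> simp

theorem swap_swap {A B W : V} (f : A ⊗ B ⟶ W) :
    lift (snd A B) (fst A B) ≫ lift (snd B A) (fst B A) ≫ f = f := by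
  rw [← Category.assoc]
  convert Category.id_comp f
  ext <;> simp

theorem idι_idDescLeft {a b : X.Obj} {A W : V} (f : a = b → (A ⟶ W))
    (g : X.Path a b ⊗ A ⟶ W) (h : a = b) :
    X.idι h ▷ A ≫ idDescLeft f g = snd _ _ ≫ f h := by
  rw [idDescLeft, ← Category.assoc, swap_whisker, Category.assoc, idι_idDescRight,
    ← Category.assoc, lift_fst]

theorem pathι_idDescLeft {a b : X.Obj} {A W : V} (f : a = b → (A ⟶ W))
    (g : X.Path a b ⊗ A ⟶ W) : X.pathι a b ▷ A ≫ idDescLeft f g = g := by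
  rw [idDescLeft, ← Category.assoc, swap_whisker, Category.assoc, pathι_idDescRight, swap_swap]

theorem id_hom_ext_right {a b : X.Obj} {A W : V} {f g : A ⊗ X.IdHom a b ⟶ W}
    (h₁ : ∀ h : a = b, A ◁ X.idι h ≫ f = A ◁ X.idι h ≫ g)
    (h₂ : A ◁ X.pathι a b ≫ f = A ◁ X.pathι a b ≫ g) : f = g := by
  apply MonoidalClosed.curry_injective
  apply id_hom_ext
  · intro h
    rw [← MonoidalClosed.curry_natural_left, ← MonoidalClosed.curry_natural_left, h₁ h]
  · rw [← MonoidalClosed.curry_natural_left, ← MonoidalClosed.curry_natural_left, h₂]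

theorem id_hom_ext_left {a b : X.Obj} {A W : V} {f g : X.IdHom a b ⊗ A ⟶ W}
    (h₁ : ∀ h : a = b, X.idι h ▷ A ≫ f = X.idι h ▷ A ≫ g)
    (h₂ : X.pathι a b ▷ A ≫ f = X.pathι a b ▷ A ≫ g) : f = g := by
  rw [← swap_swap f, ← swap_swap g]
  congr 1
  apply id_hom_ext_right
  · intro h
    rw [swap_whiskerLeft, swap_whiskerLeft, h₁ h]
  · rw [swap_whiskerLeft, swap_whiskerLeft, h₂]

variable (X)

/-- The composition after adding identities: the added identities are neutral, and execution
paths are composed as in `X`. -/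
def idComp (a b c : X.Obj) : X.IdHom a b ⊗ X.IdHom b c ⟶ X.IdHom a c :=
  idDescLeft (fun h => eqToHom (by rw [h]))
    (idDescRight (fun h => X.pathι a b ≫ eqToHom (by rw [h])) (X.comp a b c ≫ X.pathι a c))

theorem lift_idι_idComp {T : V} {a b : X.Obj} (h : a = b) {c : X.Obj} (g : T ⟶ X.IdHom b c) :
    lift (toUnit T ≫ X.idι h) g ≫ X.idComp a b c = g ≫ eqToHom (by rw [h]) := by
  have : lift (toUnit T ≫ X.idι h) g = lift (toUnit T) g ≫ X.idι h ▷ _ := by simp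
  rw [this, Category.assoc, idComp, idι_idDescLeft, lift_snd_assoc]

theorem lift_pathι_idι_idComp {T : V} (a : X.Obj) {b c : X.Obj} (h : b = c)
    (g : T ⟶ X.Path a b) :
    lift (g ≫ X.pathι a b) (toUnit T ≫ X.idι h) ≫ X.idComp a b c =
      g ≫ X.pathι a b ≫ eqToHom (by rw [h]) := by
  have : lift (g ≫ X.pathι a b) (toUnit T ≫ X.idι h) =
    lift g (toUnit T) ≫ _ ◁ X.idι h ≫ X.pathι a b ▷ _ := by simp
  rw [this, Category.assoc, Category.assoc, idComp, pathι_idDescLeft, idι_idDescRight,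
    lift_fst_assoc]

theorem lift_idComp_idι {T : V} (a : X.Obj) {b c : X.Obj} (h : b = c) (g : T ⟶ X.IdHom a b) :
    lift g (toUnit T ≫ X.idι h) ≫ X.idComp a b c = g ≫ eqToHom (by rw [h]) := by
  have key : lift (𝟙 _) (toUnit _ ≫ X.idι h) ≫ X.idComp a b c = eqToHom (by rw [h]) := by
    apply id_hom_ext
    · intro h'
      have e : X.idι h' ≫ lift (𝟙 _) (toUnit _ ≫ X.idι h) =
          lift (toUnit _ ≫ X.idι h') (X.idι h) := by
        ext <;> simp [toUnit_unique (toUnit _) (𝟙 (𝟙_ V))]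
      rw [← Category.assoc, e, lift_idι_idComp]
      cases h'
      cases h
      simp
    · have e : X.pathι a b ≫ lift (𝟙 _) (toUnit _ ≫ X.idι h) =
          lift (𝟙 _ ≫ X.pathι a b) (toUnit _ ≫ X.idι h) := by
        ext <;> simp
      rw [← Category.assoc, e, lift_pathι_idι_idComp, Category.id_comp]
  rw [← key, ← Category.assoc]
  congr 1
  ext <;> simp

theorem lift_pathι_idComp {T : V} (a b c : X.Obj) (f : T ⟶ X.Path a b) (g : T ⟶ X.Path b c) :
    lift (f ≫ X.pathι a b) (g ≫ X.pathι b c) ≫ X.idComp a b c =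
      lift f g ≫ X.comp a b c ≫ X.pathι a c := by
  have : lift (f ≫ X.pathι a b) (g ≫ X.pathι b c) =
    lift f g ≫ _ ◁ X.pathι b c ≫ X.pathι a b ▷ _ := by simp
  rw [this, Category.assoc, Category.assoc, idComp, pathι_idDescLeft, pathι_idDescRight]

theorem id_hom_ext_mid {a b : X.Obj} {A B W : V} {f g : A ⊗ (X.IdHom a b ⊗ B) ⟶ W}
    (h₁ : ∀ h : a = b, A ◁ (X.idι h ▷ B) ≫ f = A ◁ (X.idι h ▷ B) ≫ g)
    (h₂ : A ◁ (X.pathι a b ▷ B) ≫ f = A ◁ (X.pathι a b ▷ B) ≫ g) : f = g := by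
  apply MonoidalClosed.curry_injective
  apply id_hom_ext_left
  · intro h
    rw [← MonoidalClosed.curry_natural_left, ← MonoidalClosed.curry_natural_left, h₁ h]
  · rw [← MonoidalClosed.curry_natural_left, ← MonoidalClosed.curry_natural_left, h₂]

theorem id_hom_ext_end {a b : X.Obj} {A B W : V} {f g : A ⊗ (B ⊗ X.IdHom a b) ⟶ W}
    (h₁ : ∀ h : a = b, A ◁ (B ◁ X.idι h) ≫ f = A ◁ (B ◁ X.idι h) ≫ g)
    (h₂ : A ◁ (B ◁ X.pathι a b) ≫ f = A ◁ (B ◁ X.pathι a b) ≫ g) : f = g := by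
  apply MonoidalClosed.curry_injective
  apply id_hom_ext_right
  · intro h
    rw [← MonoidalClosed.curry_natural_left, ← MonoidalClosed.curry_natural_left, h₁ h]
  · rw [← MonoidalClosed.curry_natural_left, ← MonoidalClosed.curry_natural_left, h₂]

theorem lift_comp_assoc {T : V} {a b c d : X.Obj} (f : T ⟶ X.Path a b) (g : T ⟶ X.Path b c)
    (h : T ⟶ X.Path c d) :
    lift (lift f g ≫ X.comp a b c) h ≫ X.comp a c d =
      lift f (lift g h ≫ X.comp b c d) ≫ X.comp a b d := by
  have := congrArg (lift (lift f g) h ≫ ·) (X.assoc a b c d)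
  simpa using this

theorem idComp_assoc (a b c d : X.Obj) :
    (α_ (X.IdHom a b) (X.IdHom b c) (X.IdHom c d)).inv ≫
        X.idComp a b c ▷ X.IdHom c d ≫ X.idComp a c d =
      X.IdHom a b ◁ X.idComp b c d ≫ X.idComp a b d := by
  have e₁ : (α_ (X.IdHom a b) (X.IdHom b c) (X.IdHom c d)).inv ≫ X.idComp a b c ▷ X.IdHom c d =
      lift (lift (fst _ _) (snd _ _ ≫ fst _ _) ≫ X.idComp a b c) (snd _ _ ≫ snd _ _) := by
    ext
    · simp only [Category.assoc, whiskerRight_fst, lift_fst]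
      rw [← Category.assoc]
      congr 1
      ext <;> simp
    · simp
  have e₂ : X.IdHom a b ◁ X.idComp b c d =
      lift (fst _ _) (lift (snd _ _ ≫ fst _ _) (snd _ _ ≫ snd _ _) ≫ X.idComp b c d) := by
    ext
    · simp
    · simp only [whiskerLeft_snd, lift_snd]
      congr 1
      ext <;> simp
  rw [← Category.assoc, e₁, e₂]
  apply id_hom_ext_left
  · intro h
    simp only [comp_lift_assoc, comp_lift, whiskerRight_fst, whiskerRight_snd_assoc]
    simp only [toUnit_unique (fst (𝟙_ V) _) (toUnit _), lift_idι_idComp]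
    cases h
    simp
  simp only [comp_lift_assoc, comp_lift, whiskerRight_fst, whiskerRight_snd_assoc]
  apply id_hom_ext_mid
  · intro h
    cases h
    simp only [comp_lift_assoc, comp_lift, whiskerLeft_fst_assoc, whiskerLeft_snd_assoc,
      whiskerRight_fst, whiskerRight_snd]
    simp only [toUnit_unique (fst (𝟙_ V) _) (toUnit _), comp_toUnit_assoc, lift_idι_idComp,
      lift_pathι_idι_idComp, eqToHom_refl, Category.comp_id]
  simp only [comp_lift_assoc, comp_lift, whiskerLeft_fst_assoc, whiskerLeft_snd_assoc,
      whiskerRight_fst, whiskerRight_snd]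
  apply id_hom_ext_end
  · intro h
    cases h
    simp only [comp_lift_assoc, comp_lift, whiskerLeft_fst_assoc, whiskerLeft_snd_assoc,
      whiskerLeft_fst, whiskerLeft_snd]
    simp only [toUnit_unique (snd _ (𝟙_ V)) (toUnit _), comp_toUnit_assoc, lift_idComp_idι,
      eqToHom_refl, Category.comp_id]
  simp only [comp_lift_assoc, comp_lift, whiskerLeft_fst_assoc, whiskerLeft_snd_assoc,
      whiskerLeft_fst, whiskerLeft_snd]
  simp only [← Category.assoc (snd _ _), lift_pathι_idComp]
  simp only [← Category.assoc (lift _ _), lift_pathι_idComp]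
  rw [lift_comp_assoc]

/-- The enriched category obtained from `X` by adding identities as isolated points. -/
def addIdObj : EnrCat.{w} V where
  Obj := X.Obj
  str :=
    { Hom := X.IdHom
      id := fun a => X.idι (rfl : a = a)
      comp := X.idComp
      id_comp := fun a b => by
        have e : (λ_ (X.IdHom a b)).inv ≫ X.idι (rfl : a = a) ▷ X.IdHom a b =
            lift (toUnit _ ≫ X.idι rfl) (𝟙 _) := by ext <;> simp
        rw [← Category.assoc, e, lift_idι_idComp]
        simp
      comp_id := fun a b => by
        have e : (ρ_ (X.IdHom a b)).inv ≫ X.IdHom a b ◁ X.idι (rfl : b = b) =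
            lift (𝟙 _) (toUnit _ ≫ X.idι rfl) := by ext <;> simp
        rw [← Category.assoc, e, lift_idComp_idι]
        simp
      assoc := X.idComp_assoc }

variable {X} {Y : EnrSemicat.{w} V}

/-- The map induced on `IdHom` by a map of flows. -/
def idMap (f : EnrSemifunctor X Y) (a b : X.Obj) :
    X.IdHom a b ⟶ Y.IdHom (f.obj a) (f.obj b) :=
  idDesc (fun h => Y.idι (congrArg f.obj h)) (f.map a b ≫ Y.pathι (f.obj a) (f.obj b))

theorem idι_idMap (f : EnrSemifunctor X Y) {a b : X.Obj} (h : a = b) :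
    X.idι h ≫ idMap f a b = Y.idι (congrArg f.obj h) :=
  idι_idDesc _ _ h

theorem pathι_idMap (f : EnrSemifunctor X Y) (a b : X.Obj) :
    X.pathι a b ≫ idMap f a b = f.map a b ≫ Y.pathι (f.obj a) (f.obj b) :=
  pathι_idDesc _ _

theorem idComp_idMap (f : EnrSemifunctor X Y) (a b c : X.Obj) :
    X.idComp a b c ≫ idMap f a c =
      (idMap f a b ⊗ₘ idMap f b c) ≫ Y.idComp (f.obj a) (f.obj b) (f.obj c) := by
  have e : ∀ {T : V} (x : T ⟶ X.IdHom a b) (y : T ⟶ X.IdHom b c),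
      lift x y ≫ (idMap f a b ⊗ₘ idMap f b c) =
        lift (x ≫ idMap f a b) (y ≫ idMap f b c) := fun x y => by simp
  have e₁ : ∀ {A B C : V} (x : A ⟶ B), x ▷ C = lift (fst _ _ ≫ x) (snd _ _) := fun x => by
    ext <;> simp
  have e₂ : ∀ {A B C D : V} (x : A ⟶ B) (y : C ⟶ D),
      C ◁ x ≫ y ▷ B = lift (fst _ _ ≫ y) (snd _ _ ≫ x) := fun x y => by
    ext <;> simp
  apply id_hom_ext_left
  · intro h
    rw [e₁, toUnit_unique (fst (𝟙_ V) _) (toUnit _), ← Category.assoc, ← Category.assoc, e,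
      Category.assoc (toUnit _), idι_idMap, lift_idι_idComp, lift_idι_idComp]
    cases h
    simp
  apply id_hom_ext_right
  · intro h
    rw [← Category.assoc, ← Category.assoc (_ ◁ _), e₂, toUnit_unique (snd _ (𝟙_ V)) (toUnit _),
      ← Category.assoc, ← Category.assoc, e, Category.assoc (toUnit _), idι_idMap,
      lift_idComp_idι, lift_idComp_idι]
    cases h
    simp
  · rw [← Category.assoc, ← Category.assoc (_ ◁ _), e₂, ← Category.assoc, ← Category.assoc, e,
      lift_pathι_idComp, Category.assoc, Category.assoc, Category.assoc, Category.assoc,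
      pathι_idMap, pathι_idMap, pathι_idMap, ← Category.assoc (fst _ _),
      ← Category.assoc (snd _ _),
      lift_pathι_idComp, ← Category.assoc (X.comp a b c), f.map_comp]
    simp

theorem idMap_id (a b : X.Obj) : idMap (𝟙 X : X ⟶ X) a b = 𝟙 (X.IdHom a b) :=
  id_hom_ext
    (fun h => (idι_idMap (𝟙 X : X ⟶ X) h).trans (Category.comp_id (X.idι h)).symm)
    ((pathι_idMap (𝟙 X : X ⟶ X) a b).trans
      ((Category.id_comp (X.pathι a b)).trans (Category.comp_id (X.pathι a b)).symm))

theorem idMap_comp {Z : EnrSemicat.{w} V} (f : X ⟶ Y) (g : Y ⟶ Z) (a b : X.Obj) :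
    idMap (f ≫ g) a b = idMap f a b ≫ idMap g (f.obj a) (f.obj b) := by
  apply id_hom_ext
  · intro h
    rw [← Category.assoc, idι_idMap f h, idι_idMap g]
    exact idι_idMap (f ≫ g) h
  · rw [← Category.assoc, pathι_idMap f, Category.assoc, pathι_idMap g, ← Category.assoc]
    exact pathι_idMap (f ≫ g) a b

end EnrSemicat

open EnrSemicat in
/-- The functor `𝕀` from flows to enriched small categories, adding an identity to every state
as an isolated point. It is left adjoint to the functor forgetting the identities. -/
def addId (V : Type u) [Category.{v} V] [CartesianMonoidalCategory V] [MonoidalClosed V]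
    [HasColimitsOfSize.{v, v} V] : EnrSemicat.{w} V ⥤ EnrCat.{w} V where
  obj X := X.addIdObj
  map f :=
    { obj := f.obj
      map := idMap f
      map_id := fun a => idι_idMap f (rfl : a = a)
      map_comp := idComp_idMap f }
  map_id _ := enrichedFunctor_ext rfl <| heq_of_eq <| funext fun a => funext fun b => idMap_id a b
  map_comp f g := enrichedFunctor_ext rfl <| heq_of_eq <| funext fun a => funext fun b =>
    idMap_comp f g a b

end Closed

/-! ### The generating cofibrations -/

/-- A locally presentable category is cocomplete. -/
instance hasColimitsOfLocallyPresentable (V : Type u) [Category.{v} V]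
    [h : IsLocallyPresentable.{v} V] : HasColimitsOfSize.{v, v} V := by
  obtain ⟨κ, _, _⟩ := h.exists_cardinal
  infer_instance

section Generators

open TopCat

variable (P : ObjectProperty TopCat.{u}) [CartesianMonoidalCategory P.FullSubcategory]
  [MonoidalClosed P.FullSubcategory] [IsLocallyPresentable.{u} P.FullSubcategory]
  (hS : ∀ n, P (∂𝔻 n)) (hD : ∀ n, P (𝔻 n))

/-- The inclusion of `S^{n-1}` in `D^n`, in the full subcategory of spaces satisfying `P`. -/
def sphereIncl (n : ℕ) :
    (⟨∂𝔻 n, hS n⟩ : P.FullSubcategory) ⟶ (⟨𝔻 n, hD n⟩ : P.FullSubcategory) :=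
  ObjectProperty.homMk (diskBoundaryInclusion n)

/-- The set of maps of flows `I^gl = {Glob(S^{n-1}) ⊂ Glob(D^n) | n ≥ 0}`. -/
def Igl : MorphismProperty (EnrSemicat.{u} P.FullSubcategory) :=
  MorphismProperty.ofHoms fun n : ℕ => Glob.map (sphereIncl P hS hD n)

/-- The map of flows `C : ∅ ⟶ {0}`. -/
def mapC : setFlow P.FullSubcategory PEmpty.{u + 1} ⟶ setFlow P.FullSubcategory PUnit.{u + 1} :=
  setFlowMap P.FullSubcategory fun a : PEmpty.{u + 1} => a.elim

/-- The set of maps of flows `I^gl ∪ {C}`. -/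
def IglC : MorphismProperty (EnrSemicat.{u} P.FullSubcategory) :=
  Igl P hS hD ⊔ MorphismProperty.ofHoms fun _ : Unit => mapC P

/-- The cofibrations of the Ilias model structure on enriched small categories: the class
`cof(𝕀(I^gl ∪ {C}))` of maps with the left lifting property with respect to all the maps with
the right lifting property with respect to `𝕀(I^gl ∪ {C})`. The trivial fibrations are
`(iliasCof P hS hD).rlp`. -/
def iliasCof : MorphismProperty (EnrCat.{u} P.FullSubcategory) :=
  ((IglC P hS hD).strictMap (addId P.FullSubcategory)).rlp.llp

end Generators

/-- The left-lifting along `F : C ⥤ D` of a weak factorization system with left class `L`: a weak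
factorization system `(L', R')` on `C` whose left class is `F⁻¹(L)`. -/
structure IsLeftLifting {C D : Type*} [Category* C] [Category* D] (F : C ⥤ D)
    (L : MorphismProperty D) (L' R' : MorphismProperty C) : Prop where
  left_eq : L' = L.inverseImage F
  isWeakFactorizationSystem : L'.IsWeakFactorizationSystem R'

end

/-!
The right lifting property with respect to `I^gl ∪ {C}` only involves the map on states and the maps
on spaces of execution paths: a map of flows has it if and only if it is surjective on states and
its maps on paths have the right lifting property with respect to the inclusions
`S^{n-1} ⊂ D^n`.

One inclusion between the left classes holds because `𝕀` is a left adjoint. Conversely, let `f` be a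
map of flows with `𝕀 f` a cofibration. Lifting against a map between codiscrete enriched categories
shows that `f` is injective on states, which allows one to replace a map `p` of
`inj(I^gl ∪ {C})` by a map which is bijective on states. Then `𝕀 p` is again a trivial fibration:
the disks are connected, so that a disk in a space of maps of `𝕀 B` either is constant at an
identity or consists of execution paths. As identities are isolated, a lift of `𝕀 f` against `𝕀 p`
restricts to a lift of `f` against `p`.

The factorizations are obtained without constructing colimits of flows. Flows with set of states `S`
are the diagrams of spaces `E a b ⟵ P a b c ⟶ E b c`, `P a b c ⟶ E a c` satisfying a Segal
condition, which over a flow is a right lifting property with respect to a set of maps of diagrams.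
The small object argument for these maps together with the inclusions `S^{n-1} ⊂ D^n` factors a map
of diagrams through a flow; the states are first enlarged to `X.Obj ⊕ Y.Obj` by a left Kan
extension, in order to get surjectivity on states.
-/

noncomputable section

/-! ### Flows, globes and sets -/

namespace EnrSemicat

variable {V : Type u} [Category.{v} V] [CartesianMonoidalCategory V]

theorem hom_ext {X Y : EnrSemicat.{w} V} {f g : X ⟶ Y} (hobj : ∀ a, f.obj a = g.obj a)
    (hmap : ∀ a b, f.map a b ≫ eqToHom (by rw [hobj, hobj]) = g.map a b) : f = g := by
  obtain ⟨o, m, hm⟩ := f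
  obtain ⟨o', m', hm'⟩ := g
  obtain rfl : o = o' := funext hobj
  obtain rfl : m = m' := funext fun a => funext fun b => by simpa using hmap a b
  rfl

theorem congr_obj {X Y : EnrSemicat.{w} V} {f g : X ⟶ Y} (h : f = g) (a : X.Obj) :
    f.obj a = g.obj a := by
  rw [h]

theorem congr_map {X Y : EnrSemicat.{w} V} {f g : X ⟶ Y} (h : f = g) (a b : X.Obj) :
    f.map a b ≫ eqToHom (by rw [h]) = g.map a b := by
  subst h
  simp

section Pull

variable (B : EnrSemicat.{w} V) {S : Type w} (h : S → B.Obj)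

/-- The flow with set of states `S` whose execution paths are those of `B` between the images of
the states under `h`. -/
@[reducible]
def pull : EnrSemicat.{w} V where
  Obj := S
  Path a b := B.Path (h a) (h b)
  comp a b c := B.comp (h a) (h b) (h c)
  assoc a b c d := B.assoc (h a) (h b) (h c) (h d)

/-- The canonical map from a pulled back flow. -/
def pullι : B.pull h ⟶ B where
  obj := h
  map _ _ := 𝟙 _
  map_comp a b c := by simp

/-- A map of flows `p : A ⟶ B` is the identity on states followed by an identity on paths: this
is the first factor, whose target is the flow `B` pulled back to the states of `A`. -/
def toPull {A : EnrSemicat.{w} V} (p : A ⟶ B) : A ⟶ B.pull p.obj where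
  obj a := a
  map a b := p.map a b
  map_comp a b c := p.map_comp a b c

theorem toPull_pullι {A : EnrSemicat.{w} V} (p : A ⟶ B) : B.toPull p ≫ B.pullι p.obj = p :=
  hom_ext (fun _ => rfl) fun a b => (Category.comp_id _).trans (Category.comp_id (p.map a b))

variable {B h}

theorem hasLiftingProperty_pullι {X Y : EnrSemicat.{w} V} {f : X ⟶ Y}
    (hf : Function.Injective f.obj) (hh : Function.Surjective h) :
    HasLiftingProperty f (B.pullι h) where
  sq_hasLift {u v} sq := by
    obtain ⟨k, hk, hv⟩ : ∃ k : Y.Obj → S, (∀ x, k (f.obj x) = u.obj x) ∧ h ∘ k = v.obj := by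
      choose g hg using hh
      refine ⟨Function.extend f.obj u.obj (g ∘ v.obj),
        fun x => hf.extend_apply _ _ _, funext fun y => ?_⟩
      by_cases hy : ∃ x, f.obj x = y
      · obtain ⟨x, rfl⟩ := hy
        exact (congrArg h (hf.extend_apply _ _ x)).trans (congr_obj sq.w x)
      · simp only [Function.comp_apply, Function.extend_apply' _ _ _ hy, hg]
    obtain ⟨vo, vm, hvm⟩ := v
    obtain rfl : h ∘ k = vo := hv
    exact ⟨⟨⟨⟨k, vm, hvm⟩,
      hom_ext hk fun a b => (congr_map sq.w.symm a b).trans (Category.comp_id _),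
      hom_ext (fun _ => rfl) fun a b => (Category.comp_id _).trans (Category.comp_id _)⟩⟩⟩

end Pull

end EnrSemicat

section Closed

variable {V : Type u} [Category.{v} V] [CartesianMonoidalCategory V] [MonoidalClosed V]
  [HasColimitsOfSize.{v, v} V]

/-- The map `copow p Y ⟶ copow p Z` induced by a map `Y ⟶ Z`. -/
def copow.map (p : Prop) {Y Z : V} (i : Y ⟶ Z) : copow p Y ⟶ copow p Z :=
  copow.desc fun h => i ≫ copow.ι h Z

theorem copow.ι_map {p : Prop} {Y Z : V} (i : Y ⟶ Z) (h : p) :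
    copow.ι h Y ≫ copow.map p i = i ≫ copow.ι h Z :=
  copow.ι_desc (fun h => i ≫ copow.ι h Z) h

theorem copow.hasLiftingProperty_map (p : Prop) {Y Z A B : V} (i : Y ⟶ Z) (r : A ⟶ B)
    [HasLiftingProperty i r] : HasLiftingProperty (copow.map p i) r where
  sq_hasLift {y z} sq := by
    have sq' (h : p) : CommSq (copow.ι h Y ≫ y) i r (copow.ι h Z ≫ z) := ⟨by
      rw [Category.assoc, sq.w, ← Category.assoc, copow.ι_map, Category.assoc]⟩
    refine ⟨⟨⟨copow.desc fun h => (sq' h).lift, copow.hom_ext fun h => ?_,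
      copow.hom_ext fun h => ?_⟩⟩⟩
    · rw [← Category.assoc, copow.ι_map, Category.assoc, copow.ι_desc, (sq' h).fac_left]
    · rw [← Category.assoc, copow.ι_desc, (sq' h).fac_right]

namespace Glob

variable {Y Z : V} {A B : EnrSemicat.{w} V}

/-- The map out of a globe sending its states to `a` and `b`, given by a map to the space of
execution paths from `a` to `b`. -/
def desc {a b : A.Obj} (z : Z ⟶ A.Path a b) : (Glob Z : EnrSemicat.{w} V) ⟶ A where
  obj x := ![a, b] x.down
  map x y := copow.desc fun h => z ≫ eqToHom (by rw [h.1, h.2]; rfl)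
  map_comp a b c := (copow.tensorIsInitial (glob_excl a b c) Z Z).hom_ext _ _

/-- The map to a space of execution paths which a map out of a globe amounts to. -/
def path (f : (Glob Z : EnrSemicat.{w} V) ⟶ A) : Z ⟶ A.Path (f.obj ⟨0⟩) (f.obj ⟨1⟩) :=
  copow.ι (p := (0 : Fin 2) = 0 ∧ (1 : Fin 2) = 1) ⟨rfl, rfl⟩ Z ≫ f.map ⟨0⟩ ⟨1⟩

theorem path_desc {a b : A.Obj} (z : Z ⟶ A.Path a b) : path (desc z) = z :=
  (copow.ι_desc (p := (0 : Fin 2) = 0 ∧ (1 : Fin 2) = 1) (fun _ => z ≫ 𝟙 _) ⟨rfl, rfl⟩).trans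
    (Category.comp_id z)

theorem path_comp (f : (Glob Z : EnrSemicat.{w} V) ⟶ A) (p : A ⟶ B) :
    path (f ≫ p) = path f ≫ p.map (f.obj ⟨0⟩) (f.obj ⟨1⟩) :=
  (Category.assoc _ _ _).symm

theorem path_map_comp (i : Y ⟶ Z) (f : (Glob Z : EnrSemicat.{w} V) ⟶ A) :
    path (map i ≫ f) = i ≫ path f :=
  (Category.assoc _ _ _).symm.trans ((congrArg (· ≫ f.map ⟨0⟩ ⟨1⟩)
    (copow.ι_map (p := (0 : Fin 2) = 0 ∧ (1 : Fin 2) = 1) i ⟨rfl, rfl⟩)).trans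
      (Category.assoc _ _ _))

theorem hom_ext {f g : (Glob Z : EnrSemicat.{w} V) ⟶ A} (h₀ : f.obj ⟨0⟩ = g.obj ⟨0⟩)
    (h₁ : f.obj ⟨1⟩ = g.obj ⟨1⟩) (h : path f ≫ eqToHom (by rw [h₀, h₁]) = path g) : f = g := by
  refine EnrSemicat.hom_ext ?_ ?_
  · rintro ⟨x⟩
    fin_cases x
    exacts [h₀, h₁]
  · rintro ⟨x⟩ ⟨y⟩
    refine copow.hom_ext ?_
    rintro ⟨hx, hy⟩
    obtain rfl : x = 0 := hx
    obtain rfl : y = 1 := hy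
    exact (Category.assoc _ _ _).symm.trans h

theorem congr_path {f g : (Glob Z : EnrSemicat.{w} V) ⟶ A} (h : f = g) :
    path f ≫ eqToHom (by rw [h]) = path g := by
  subst h
  simp

theorem commSq_desc {i : Y ⟶ Z} {p : A ⟶ B} {a b : A.Obj} {y : Y ⟶ A.Path a b}
    {z : Z ⟶ B.Path (p.obj a) (p.obj b)} (sq : CommSq y i (p.map a b) z) :
    CommSq (desc y) (map i) p (desc z) where
  w := hom_ext rfl rfl <| (Category.comp_id _).trans <| (path_comp _ _).trans <|
    (congrArg (· ≫ p.map a b) (path_desc y)).trans <| sq.w.trans <|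
      (congrArg (i ≫ ·) (path_desc z)).symm.trans (path_map_comp _ _).symm

theorem hasLiftingProperty_map_iff (i : Y ⟶ Z) (p : A ⟶ B) :
    HasLiftingProperty (map i : (Glob Y : EnrSemicat.{w} V) ⟶ Glob Z) p ↔
      ∀ a b, HasLiftingProperty i (p.map a b) := by
  constructor
  · refine fun _ a b => ⟨fun {y z} sq => ?_⟩
    obtain ⟨⟨⟨l, hy, hz⟩⟩⟩ : (commSq_desc sq).HasLift := inferInstance
    have ha : l.obj ⟨0⟩ = a := EnrSemicat.congr_obj hy ⟨0⟩
    have hb : l.obj ⟨1⟩ = b := EnrSemicat.congr_obj hy ⟨1⟩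
    have hy' := congr_path hy
    have hz' := congr_path hz
    rw [path_map_comp, path_desc] at hy'
    rw [path_comp, path_desc] at hz'
    subst ha hb
    refine ⟨⟨⟨path l, (Category.comp_id _).symm.trans hy',
      (Category.comp_id _).symm.trans hz'⟩⟩⟩
  · refine fun _ => ⟨fun {q q'} sq => ?_⟩
    obtain ⟨o, m, hm⟩ := q'
    obtain rfl : (fun x => p.obj (q.obj x)) = o := funext (EnrSemicat.congr_obj sq.w)
    have exists_lift (x y : ULift.{w} (Fin 2)) :
        ∃ l, copow.map (x.down = 0 ∧ y.down = 1) i ≫ l = q.map x y ∧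
          l ≫ p.map (q.obj x) (q.obj y) = m x y := by
      have sq' : CommSq (q.map x y) (copow.map (x.down = 0 ∧ y.down = 1) i)
          (p.map (q.obj x) (q.obj y)) (m x y) :=
        ⟨(Category.comp_id _).symm.trans (EnrSemicat.congr_map sq.w x y)⟩
      obtain ⟨⟨l⟩⟩ := (copow.hasLiftingProperty_map (x.down = 0 ∧ y.down = 1) i
        (p.map (q.obj x) (q.obj y))).sq_hasLift sq'
      exact ⟨l.l, l.fac_left, l.fac_right⟩
    choose l hl hl' using exists_lift
    exact ⟨⟨⟨{ obj := q.obj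
               map := l
               map_comp := fun a b c =>
                 (copow.tensorIsInitial (glob_excl a b c) Z Z).hom_ext _ _ },
      EnrSemicat.hom_ext (fun _ => rfl) fun x y => (Category.comp_id _).trans (hl x y),
      EnrSemicat.hom_ext (fun _ => rfl) fun x y => (Category.comp_id _).trans (hl' x y)⟩⟩⟩

end Glob

/-- A map of sets extends to a map of flows out of a set. -/
def setFlow.desc {S : Type w} {A : EnrSemicat.{w} V} (o : S → A.Obj) : setFlow V S ⟶ A where
  obj := o
  map _ _ := initial.to _
  map_comp _ _ _ := (tensorRightInitial initialIsInitial).hom_ext _ _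

theorem setFlow.hom_ext {S : Type w} {A : EnrSemicat.{w} V} {f g : setFlow V S ⟶ A}
    (h : ∀ s : S, f.obj s = g.obj s) : f = g :=
  EnrSemicat.hom_ext h fun _ _ => initialIsInitial.hom_ext _ _

theorem setFlow.hasLiftingProperty_iff {A B : EnrSemicat.{w} V} (p : A ⟶ B) :
    HasLiftingProperty (setFlowMap V fun a : PEmpty.{w + 1} => (a.elim : PUnit.{w + 1})) p ↔
      Function.Surjective p.obj := by
  constructor
  · intro _ b
    have sq : CommSq (setFlow.desc PEmpty.elim) (setFlowMap V fun a : PEmpty.{w + 1} => a.elim) p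
        (setFlow.desc fun _ : PUnit.{w + 1} => b) := ⟨setFlow.hom_ext fun s => s.elim⟩
    exact ⟨sq.lift.obj PUnit.unit, EnrSemicat.congr_obj sq.fac_right PUnit.unit⟩
  · refine fun hp => ⟨fun {_ v} _ => ?_⟩
    choose s hs using hp
    exact ⟨⟨⟨setFlow.desc (s ∘ v.obj), setFlow.hom_ext fun x => x.elim,
      setFlow.hom_ext fun x => hs (v.obj x)⟩⟩⟩

/-- For a family `i` of maps of spaces, the maps of flows `Glob(i n)` together with the map
`∅ ⟶ {0}`. -/
def globGens {ι : Type*} {s d : ι → V} (i : ∀ n, s n ⟶ d n) :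
    MorphismProperty (EnrSemicat.{w} V) :=
  MorphismProperty.ofHoms (fun n => Glob.map (i n)) ⊔
    MorphismProperty.ofHoms fun _ : Unit => setFlowMap V fun a : PEmpty.{w + 1} =>
      (a.elim : PUnit.{w + 1})

theorem rlp_globGens_iff {ι : Type*} {s d : ι → V} (i : ∀ n, s n ⟶ d n)
    {A B : EnrSemicat.{w} V} (p : A ⟶ B) :
    (globGens i).rlp p ↔
      Function.Surjective p.obj ∧ ∀ n a b, HasLiftingProperty (i n) (p.map a b) := by
  rw [← setFlow.hasLiftingProperty_iff (V := V)]
  constructor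
  · exact fun hp => ⟨hp _ (.inr ⟨()⟩), fun n =>
      (Glob.hasLiftingProperty_map_iff (i n) p).1 (hp _ (.inl ⟨n⟩))⟩
  · rintro ⟨h, h'⟩ _ _ _ (hf | hf)
    · cases hf with | mk n => exact (Glob.hasLiftingProperty_map_iff (i n) p).2 (h' n)
    · cases hf with | mk => exact h

end Closed

/-! ### The adjunction between adding and forgetting identities -/

/-- The flow underlying an enriched category, forgetting that identities exist. -/
@[reducible]
def EnrCat.toSemicat {V : Type u} [Category.{v} V] [CartesianMonoidalCategory V]
    (C : EnrCat.{w} V) : EnrSemicat.{w} V where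
  Obj := C.Obj
  Path a b := EnrichedCategory.Hom a b
  comp := eComp V
  assoc a b c d := by rw [← e_assoc, Iso.hom_inv_id_assoc]

/-- The functor forgetting that identities exist. -/
def forgetId (V : Type u) [Category.{v} V] [CartesianMonoidalCategory V] :
    EnrCat.{w} V ⥤ EnrSemicat.{w} V where
  obj C := C.toSemicat
  map {C D} F := (⟨F.obj, F.map, F.map_comp⟩ : EnrSemifunctor C.toSemicat D.toSemicat)

section Adjunction

variable {V : Type u} [Category.{v} V] [CartesianMonoidalCategory V] [MonoidalClosed V]
  [HasColimitsOfSize.{v, v} V] {X Y : EnrSemicat.{w} V} {C : EnrCat.{w} V}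

namespace EnrSemicat

theorem id_hom_ext_tensor {a b c d : X.Obj} {W : V} {f g : X.IdHom a b ⊗ X.IdHom c d ⟶ W}
    (h₁ : ∀ h : a = b, X.idι h ▷ _ ≫ f = X.idι h ▷ _ ≫ g)
    (h₂ : ∀ h : c = d, _ ◁ X.idι h ≫ f = _ ◁ X.idι h ≫ g)
    (h₃ : (X.pathι a b ⊗ₘ X.pathι c d) ≫ f = (X.pathι a b ⊗ₘ X.pathι c d) ≫ g) : f = g := by
  refine id_hom_ext_left h₁ (id_hom_ext_right (fun h => ?_) ?_)
  · rw [whisker_exchange_assoc, h₂ h, whisker_exchange_assoc]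
  · simpa only [tensorHom_def', Category.assoc] using h₃

variable (X) in
theorem idι_whiskerRight_idComp (a b : X.Obj) :
    X.idι (rfl : a = a) ▷ X.IdHom a b ≫ X.idComp a a b = (λ_ _).hom :=
  (Iso.inv_comp_eq_id _).1 (e_id_comp V (C := X.addIdObj.Obj) a b)

variable (X) in
theorem whiskerLeft_idι_idComp (a b : X.Obj) :
    X.IdHom a b ◁ X.idι (rfl : b = b) ≫ X.idComp a b b = (ρ_ _).hom :=
  (Iso.inv_comp_eq_id _).1 (e_comp_id V (C := X.addIdObj.Obj) a b)

variable (X) in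
theorem pathι_tensor_idComp (a b c : X.Obj) :
    (X.pathι a b ⊗ₘ X.pathι b c) ≫ X.idComp a b c = X.comp a b c ≫ X.pathι a c := by
  simpa only [lift_fst_comp_snd_comp, lift_fst_snd, Category.id_comp] using
    X.lift_pathι_idComp a b c (fst _ _) (snd _ _)

/-- The inclusion of a flow in the flow obtained by adding, and then forgetting, identities. -/
def toAddIdObj (X : EnrSemicat.{w} V) : X ⟶ X.addIdObj.toSemicat where
  obj a := a
  map := X.pathι
  map_comp a b c := (X.pathι_tensor_idComp a b c).symm

/-- The map on `IdHom` induced by a map of flows to an enriched category. -/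
def idExtend (f : X ⟶ C.toSemicat) (a b : X.Obj) :
    X.IdHom a b ⟶ EnrichedCategory.Hom (V := V) (C := C.Obj) (f.obj a) (f.obj b) :=
  idDesc (fun h => eId V (f.obj a) ≫ eqToHom (by rw [h])) (f.map a b)

theorem idι_idExtend (f : X ⟶ C.toSemicat) (a : X.Obj) :
    X.idι (rfl : a = a) ≫ idExtend f a a = eId V (C := C.Obj) (f.obj a) :=
  (idι_idDesc _ _ _).trans (Category.comp_id _)

theorem pathι_idExtend (f : X ⟶ C.toSemicat) (a b : X.Obj) :
    X.pathι a b ≫ idExtend f a b = f.map a b :=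
  pathι_idDesc _ _

theorem idComp_idExtend (f : X ⟶ C.toSemicat) (a b c : X.Obj) :
    X.idComp a b c ≫ idExtend f a c =
      (idExtend f a b ⊗ₘ idExtend f b c) ≫ eComp V (C := C.Obj) (f.obj a) (f.obj b) (f.obj c) := by
  refine id_hom_ext_tensor ?_ ?_ ?_
  · intro h
    cases h
    have := (Iso.inv_comp_eq_id _).1 (e_id_comp V (f.obj a) (f.obj c))
    rw [← Category.assoc, idι_whiskerRight_idComp, MonoidalCategory.tensorHom_def, ← Category.assoc,
      ← Category.assoc, ← comp_whiskerRight, idι_idExtend, ← whisker_exchange, Category.assoc, this]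
    simp
  · intro h
    cases h
    have := (Iso.inv_comp_eq_id _).1 (e_comp_id V (f.obj a) (f.obj b))
    rw [← Category.assoc, whiskerLeft_idι_idComp, tensorHom_def', ← Category.assoc,
      ← Category.assoc, ← whiskerLeft_comp, idι_idExtend, whisker_exchange, Category.assoc, this]
    simp
  · rw [← Category.assoc, pathι_tensor_idComp, Category.assoc, pathι_idExtend, f.map_comp,
      ← Category.assoc, tensorHom_comp_tensorHom, pathι_idExtend, pathι_idExtend]

/-- The map of flows underlying an enriched functor out of `X.addIdObj`. -/
def idRestrict (F : X.addIdObj ⟶ C) : X ⟶ C.toSemicat :=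
  X.toAddIdObj ≫ (forgetId V).map F

theorem idExtend_idRestrict (F : X.addIdObj ⟶ C) (a b : X.Obj) :
    idExtend (idRestrict F) a b = F.map a b := by
  refine id_hom_ext (fun h => ?_) (pathι_idExtend (idRestrict F) a b)
  cases h
  exact (idι_idExtend (idRestrict F) a).trans (F.map_id a).symm

theorem idExtend_comp (f : X ⟶ Y) (g : Y ⟶ C.toSemicat) (a b : X.Obj) :
    idExtend (f ≫ g) a b = idMap f a b ≫ idExtend g (f.obj a) (f.obj b) := by
  refine id_hom_ext (fun h => ?_) ?_
  · cases h
    rw [idι_idExtend, ← Category.assoc, idι_idMap]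
    exact (idι_idExtend g (f.obj a)).symm
  · rw [pathι_idExtend, ← Category.assoc, pathι_idMap, Category.assoc, pathι_idExtend]
    rfl

end EnrSemicat

open EnrSemicat in
/-- The functor adding identities is left adjoint to the functor forgetting that they exist. -/
def addIdAdjunction (V : Type u) [Category.{v} V] [CartesianMonoidalCategory V]
    [MonoidalClosed V] [HasColimitsOfSize.{v, v} V] : addId.{w} V ⊣ forgetId.{w} V :=
  Adjunction.mkOfHomEquiv
    { homEquiv := fun X C =>
        { toFun := idRestrict
          invFun := fun f => (⟨f.obj, idExtend f, idι_idExtend f, idComp_idExtend f⟩ :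
            EnrichedFunctor V X.addIdObj.Obj C.Obj)
          left_inv := fun F => enrichedFunctor_ext rfl <| heq_of_eq <| funext fun a =>
            funext fun b => idExtend_idRestrict F a b
          right_inv := fun f => EnrSemicat.hom_ext (fun _ => rfl) fun a b =>
            (Category.comp_id _).trans (pathι_idExtend f a b) }
      homEquiv_naturality_left_symm := fun f g => enrichedFunctor_ext rfl <| heq_of_eq <|
        funext fun a => funext fun b => idExtend_comp f g a b
      homEquiv_naturality_right := fun f g =>
        (Category.assoc _ ((forgetId V).map f) ((forgetId V).map g)).symm }

theorem hasLiftingProperty_addId_iff (i : X ⟶ Y) {C D : EnrCat.{w} V} (q : C ⟶ D) :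
    HasLiftingProperty ((addId V).map i) q ↔ HasLiftingProperty i ((forgetId V).map q) :=
  (addIdAdjunction V).hasLiftingProperty_iff i q

theorem rlp_strictMap_addId_iff (W : MorphismProperty (EnrSemicat.{w} V)) {C D : EnrCat.{w} V}
    (q : C ⟶ D) : (W.strictMap (addId V)).rlp q ↔ W.rlp ((forgetId V).map q) := by
  constructor
  · exact fun h _ _ i hi => (hasLiftingProperty_addId_iff i q).1 (h _ ⟨hi⟩)
  · rintro h _ _ _ ⟨hi⟩
    exact (hasLiftingProperty_addId_iff _ q).2 (h _ hi)

theorem llp_rlp_le_inverseImage_addId (W : MorphismProperty (EnrSemicat.{w} V)) :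
    W.rlp.llp ≤ (W.strictMap (addId V)).rlp.llp.inverseImage (addId V) :=
  fun _ _ f hf _ _ q hq =>
    (hasLiftingProperty_addId_iff f q).2 (hf _ ((rlp_strictMap_addId_iff W q).1 hq))

end Adjunction

/-! ### Separating the added identities from the execution paths -/

section Indicator

/-- Connectedness: an object with a point, each of whose maps to the coproduct of two points is
constant at one of the two points. -/
structure IsConnectedObject {V : Type u} [Category.{v} V] [CartesianMonoidalCategory V]
    [HasBinaryCoproduct (𝟙_ V) (𝟙_ V)] (D : V) : Prop where
  nonempty : Nonempty (𝟙_ V ⟶ D)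
  eq_inl_or_eq_inr (c : D ⟶ 𝟙_ V ⨿ 𝟙_ V) :
    c = toUnit D ≫ coprod.inl ∨ c = toUnit D ≫ coprod.inr

/-- Two properties shared by all categories of spaces: the coproduct of two points has two distinct
points, and an object without points is initial. -/
structure HasEnoughPoints (V : Type u) [Category.{v} V] [CartesianMonoidalCategory V]
    [HasBinaryCoproduct (𝟙_ V) (𝟙_ V)] : Prop where
  inl_ne_inr : (coprod.inl : 𝟙_ V ⟶ 𝟙_ V ⨿ 𝟙_ V) ≠ coprod.inr
  nonempty_or_isInitial (K : V) : Nonempty (𝟙_ V ⟶ K) ∨ Nonempty (IsInitial K)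

variable {V : Type u} [Category.{v} V] [CartesianMonoidalCategory V]

section

variable [HasBinaryCoproduct (𝟙_ V) (𝟙_ V)]

theorem HasEnoughPoints.toUnit_comp_inl_ne (hV : HasEnoughPoints V) {K : V} (k : 𝟙_ V ⟶ K) :
    toUnit K ≫ (coprod.inl : 𝟙_ V ⟶ 𝟙_ V ⨿ 𝟙_ V) ≠ toUnit K ≫ coprod.inr := by
  intro h
  have := congrArg (k ≫ ·) h
  simp only [comp_toUnit_assoc, toUnit_unique (toUnit (𝟙_ V)) (𝟙 (𝟙_ V)), Category.id_comp] at this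
  exact hV.inl_ne_inr this

variable [MonoidalClosed V] {A W : V}

/-- The map out of `A ⊗ (𝟙_ V ⨿ 𝟙_ V)` which is `g₀` on the first copy of `A` and `g₁` on the
second one. -/
def caseTwo (g₀ g₁ : A ⟶ W) : A ⊗ (𝟙_ V ⨿ 𝟙_ V) ⟶ W :=
  MonoidalClosed.uncurry (coprod.desc (MonoidalClosed.curry (fst A (𝟙_ V) ≫ g₀))
    (MonoidalClosed.curry (fst A (𝟙_ V) ≫ g₁)))

theorem lift_inl_caseTwo (g₀ g₁ : A ⟶ W) {T : V} (x : T ⟶ A) :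
    lift x (toUnit T ≫ coprod.inl) ≫ caseTwo g₀ g₁ = x ≫ g₀ := by
  have : lift x (toUnit T ≫ coprod.inl) = lift x (toUnit T) ≫ A ◁ coprod.inl (Y := 𝟙_ V) := by
    simp
  rw [this, caseTwo, Category.assoc, ← MonoidalClosed.uncurry_natural_left, coprod.inl_desc,
    MonoidalClosed.uncurry_curry, lift_fst_assoc]

theorem lift_inr_caseTwo (g₀ g₁ : A ⟶ W) {T : V} (x : T ⟶ A) :
    lift x (toUnit T ≫ coprod.inr) ≫ caseTwo g₀ g₁ = x ≫ g₁ := by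
  have : lift x (toUnit T ≫ coprod.inr) = lift x (toUnit T) ≫ A ◁ coprod.inr (X := 𝟙_ V) := by
    simp
  rw [this, caseTwo, Category.assoc, ← MonoidalClosed.uncurry_natural_left, coprod.inr_desc,
    MonoidalClosed.uncurry_curry, lift_fst_assoc]

end

variable [MonoidalClosed V] [HasColimitsOfSize.{v, v} V] {X Y A B : EnrSemicat.{w} V}

namespace EnrSemicat

/-- The map to a coproduct of two points separating the added identities from the execution
paths. -/
def idIndicator (X : EnrSemicat.{w} V) (a b : X.Obj) : X.IdHom a b ⟶ 𝟙_ V ⨿ 𝟙_ V :=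
  idDesc (fun _ => coprod.inl) (toUnit _ ≫ coprod.inr)

theorem idι_idIndicator {a b : X.Obj} (h : a = b) :
    X.idι h ≫ idIndicator X a b = coprod.inl :=
  idι_idDesc _ _ h

theorem pathι_idIndicator (a b : X.Obj) :
    X.pathι a b ≫ idIndicator X a b = toUnit _ ≫ coprod.inr :=
  pathι_idDesc _ _

theorem idMap_idIndicator (f : X ⟶ Y) (a b : X.Obj) :
    idMap f a b ≫ idIndicator Y (f.obj a) (f.obj b) = idIndicator X a b := by
  refine id_hom_ext (fun h => ?_) ?_
  · rw [← Category.assoc, idι_idMap, idι_idIndicator, idι_idIndicator]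
  · rw [← Category.assoc, pathι_idMap, Category.assoc, pathι_idIndicator, pathι_idIndicator,
      comp_toUnit_assoc]

theorem lift_idIndicator_caseTwo {a b : X.Obj} {W : V} {f₀ f₁ f : X.IdHom a b ⟶ W}
    (h₀ : ∀ h : a = b, X.idι h ≫ f₀ = X.idι h ≫ f) (h₁ : X.pathι a b ≫ f₁ = X.pathι a b ≫ f) :
    lift (𝟙 _) (idIndicator X a b) ≫ caseTwo f₀ f₁ = f := by
  refine id_hom_ext (fun h => ?_) ?_
  · rw [comp_lift_assoc, idι_idIndicator, Category.comp_id, ← h₀ h, ← lift_inl_caseTwo f₀ f₁,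
      toUnit_unique (toUnit _) (𝟙 (𝟙_ V)), Category.id_comp]
  · rw [comp_lift_assoc, pathι_idIndicator, Category.comp_id, lift_inr_caseTwo, h₁]

variable {a b : X.Obj} {K : V} {g : K ⟶ X.IdHom a b}

theorem comp_eq_comp_of_idIndicator_inl (hg : g ≫ idIndicator X a b = toUnit K ≫ coprod.inl)
    {W : V} {f f' : X.IdHom a b ⟶ W} (h : ∀ h : a = b, X.idι h ≫ f = X.idι h ≫ f') :
    g ≫ f = g ≫ f' := by
  rw [← lift_idIndicator_caseTwo h rfl, comp_lift_assoc, hg, Category.comp_id, lift_inl_caseTwo]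

theorem comp_eq_comp_of_idIndicator_inr (hg : g ≫ idIndicator X a b = toUnit K ≫ coprod.inr)
    {W : V} {f f' : X.IdHom a b ⟶ W} (h : X.pathι a b ≫ f = X.pathι a b ≫ f') :
    g ≫ f = g ≫ f' := by
  rw [← lift_idIndicator_caseTwo (fun _ => rfl) h, comp_lift_assoc, hg, Category.comp_id,
    lift_inr_caseTwo]

theorem eq_idι_of_idIndicator (h : a = b)
    (hg : g ≫ idIndicator X a b = toUnit K ≫ coprod.inl) : g = toUnit K ≫ X.idι h := by
  have := comp_eq_comp_of_idIndicator_inl hg (f := 𝟙 _) (f' := toUnit _ ≫ X.idι h) fun h' => by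
    rw [Category.comp_id, comp_toUnit_assoc, toUnit_unique (toUnit _) (𝟙 (𝟙_ V)),
      Category.id_comp]
  rwa [Category.comp_id, comp_toUnit_assoc] at this

theorem eq_of_idIndicator (hV : HasEnoughPoints V) (k : 𝟙_ V ⟶ K)
    (hg : g ≫ idIndicator X a b = toUnit K ≫ coprod.inl) : a = b := by
  by_contra h
  refine hV.toUnit_comp_inl_ne k ?_
  have := comp_eq_comp_of_idIndicator_inl hg (f := toUnit _ ≫ coprod.inl)
    (f' := toUnit _ ≫ coprod.inr) fun h' => absurd h' h
  rwa [comp_toUnit_assoc, comp_toUnit_assoc] at this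

theorem exists_comp_pathι (hV : HasEnoughPoints V)
    (hg : g ≫ idIndicator X a b = toUnit K ≫ coprod.inr) : ∃ g', g' ≫ X.pathι a b = g := by
  obtain ⟨⟨x⟩⟩ | ⟨⟨hP⟩⟩ := hV.nonempty_or_isInitial (X.Path a b)
  · refine ⟨g ≫ idDesc (fun _ => x) (𝟙 _), ?_⟩
    have := comp_eq_comp_of_idIndicator_inr hg (f := idDesc (fun _ => x) (𝟙 _) ≫ X.pathι a b)
      (f' := 𝟙 _) (by rw [← Category.assoc, pathι_idDesc, Category.id_comp, Category.comp_id])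
    rwa [Category.comp_id, ← Category.assoc] at this
  · obtain ⟨⟨k⟩⟩ | ⟨⟨hK⟩⟩ := hV.nonempty_or_isInitial K
    · have := comp_eq_comp_of_idIndicator_inr hg (f := toUnit _ ≫ coprod.inl)
        (f' := toUnit _ ≫ coprod.inr) (hP.hom_ext _ _)
      rw [comp_toUnit_assoc, comp_toUnit_assoc] at this
      exact absurd this (hV.toUnit_comp_inl_ne k)
    · exact ⟨hK.to _, hK.hom_ext _ _⟩

instance mono_pathι (X : EnrSemicat.{w} V) (a b : X.Obj) : Mono (X.pathι a b) :=
  have := IsCartesianDistributive.of_isMonoidalLeftDistrib V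
  have : MonoCoprod V := inferInstance
  inferInstanceAs (Mono (coprod.inr : X.Path a b ⟶ copow (a = b) (𝟙_ V) ⨿ X.Path a b))

instance mono_toAddIdObj (X : EnrSemicat.{w} V) : Mono X.toAddIdObj where
  right_cancellation {Z} g h w := by
    obtain ⟨o, m, hm⟩ := g
    obtain ⟨o', m', hm'⟩ := h
    obtain rfl : o = o' := funext (congr_obj w)
    exact hom_ext (fun _ => rfl) fun a b => (Category.comp_id _).trans <|
      (cancel_mono (X.pathι _ _)).1 <| (Category.comp_id _).symm.trans (congr_map w a b)

theorem addId_map_injective {f g : X ⟶ Y} (h : (addId V).map f = (addId V).map g) : f = g := by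
  have naturality (f : X ⟶ Y) :
      X.toAddIdObj ≫ (forgetId V).map ((addId V).map f) = f ≫ Y.toAddIdObj :=
    hom_ext (fun _ => rfl) fun a b => (Category.comp_id _).trans (pathι_idMap f a b)
  rw [← cancel_mono Y.toAddIdObj, ← naturality, ← naturality, h]

theorem hasLiftingProperty_idMap (hV : HasEnoughPoints V) {S D : V} (i : S ⟶ D)
    (hD : IsConnectedObject D) (p : A ⟶ B) (hp : Function.Injective p.obj) (a b : A.Obj)
    [HasLiftingProperty i (p.map a b)] : HasLiftingProperty i (idMap p a b) where
  sq_hasLift {x y} sq := by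
    have hx : x ≫ idIndicator A a b = i ≫ y ≫ idIndicator B (p.obj a) (p.obj b) := by
      rw [← idMap_idIndicator p, sq.w_assoc]
    obtain ⟨d⟩ := hD.nonempty
    obtain hy | hy := hD.eq_inl_or_eq_inr (y ≫ idIndicator B (p.obj a) (p.obj b))
    · have hab : a = b := hp <| eq_of_idIndicator hV d hy
      rw [hy, comp_toUnit_assoc] at hx
      refine ⟨⟨⟨toUnit D ≫ A.idι hab, ?_, ?_⟩⟩⟩
      · rw [comp_toUnit_assoc, ← eq_idι_of_idIndicator hab hx]
      · rw [Category.assoc, idι_idMap, ← eq_idι_of_idIndicator (congrArg p.obj hab) hy]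
    · rw [hy, comp_toUnit_assoc] at hx
      obtain ⟨x, rfl⟩ := exists_comp_pathι hV hx
      obtain ⟨y, rfl⟩ := exists_comp_pathι hV hy
      have sq' : CommSq x i (p.map a b) y := ⟨by
        rw [← cancel_mono (B.pathι _ _), Category.assoc, ← pathι_idMap, Category.assoc,
          ← Category.assoc, sq.w]⟩
      refine ⟨⟨⟨sq'.lift ≫ A.pathι a b, ?_, ?_⟩⟩⟩
      · rw [← Category.assoc, sq'.fac_left]
      · rw [Category.assoc, pathι_idMap, ← Category.assoc, sq'.fac_right]

theorem exists_comp_pathι_eq_pathι_comp (hV : HasEnoughPoints V) {o : X.Obj → Y.Obj}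
    {m : ∀ a b, X.IdHom a b ⟶ Y.IdHom (o a) (o b)}
    (hm : ∀ a b, m a b ≫ idIndicator Y (o a) (o b) = idIndicator X a b)
    (hc : ∀ a b c, X.idComp a b c ≫ m a c = (m a b ⊗ₘ m b c) ≫ Y.idComp (o a) (o b) (o c)) :
    ∃ n : ∀ a b, X.Path a b ⟶ Y.Path (o a) (o b),
      (∀ a b, n a b ≫ Y.pathι (o a) (o b) = X.pathι a b ≫ m a b) ∧
        ∀ a b c, X.comp a b c ≫ n a c = (n a b ⊗ₘ n b c) ≫ Y.comp (o a) (o b) (o c) := by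
  have hpath (a b : X.Obj) := exists_comp_pathι (g := X.pathι a b ≫ m a b) hV <| by
    rw [Category.assoc, hm, pathι_idIndicator]
  choose n hn using hpath
  refine ⟨n, hn, fun a b c => ?_⟩
  rw [← cancel_mono (Y.pathι _ _), Category.assoc, hn, Category.assoc, ← pathι_tensor_idComp,
    ← Category.assoc, ← Category.assoc, tensorHom_comp_tensorHom, hn, hn,
    ← tensorHom_comp_tensorHom, Category.assoc (_ ⊗ₘ _), ← hc, ← Category.assoc,
    pathι_tensor_idComp]

theorem exists_addId_map_eq (hV : HasEnoughPoints V) (g : X.addIdObj ⟶ Y.addIdObj)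
    (hg : ∀ a b : X.Obj, g.map a b ≫ idIndicator Y (g.obj a) (g.obj b) = idIndicator X a b) :
    ∃ f : X ⟶ Y, (addId V).map f = g := by
  obtain ⟨n, hn, hnc⟩ := exists_comp_pathι_eq_pathι_comp hV hg g.map_comp
  refine ⟨⟨g.obj, n, hnc⟩, enrichedFunctor_ext rfl <| heq_of_eq <| funext fun a => funext fun b =>
    id_hom_ext (fun h => ?_) ((pathι_idMap _ _ _).trans (hn a b))⟩
  cases h
  exact (idι_idMap _ _).trans (g.map_id a).symm

theorem map_idIndicator_of_comp {l : Y.addIdObj ⟶ A.addIdObj} {p : A ⟶ B} {g : Y ⟶ B}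
    (h : l ≫ (addId V).map p = (addId V).map g) (a b : Y.Obj) :
    l.map a b ≫ idIndicator A (l.obj a) (l.obj b) = idIndicator Y a b := by
  have congr_comp_idIndicator {F G : Y.addIdObj ⟶ B.addIdObj} (e : F = G) :
      F.map a b ≫ idIndicator B (F.obj a) (F.obj b) =
        G.map a b ≫ idIndicator B (G.obj a) (G.obj b) := by
    rw [e]
  exact (congrArg (l.map a b ≫ ·) (idMap_idIndicator p _ _).symm).trans <|
    (Category.assoc _ _ _).symm.trans <| (congr_comp_idIndicator h).trans (idMap_idIndicator g a b)

theorem hasLiftingProperty_of_addId (hV : HasEnoughPoints V) (f : X ⟶ Y) (p : A ⟶ B)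
    (H : HasLiftingProperty ((addId V).map f) ((addId V).map p)) : HasLiftingProperty f p where
  sq_hasLift {u v} sq := by
    obtain ⟨⟨⟨l, hl, hl'⟩⟩⟩ := H.sq_hasLift (sq.map (addId V))
    obtain ⟨l, rfl⟩ := exists_addId_map_eq hV l (map_idIndicator_of_comp hl')
    rw [← Functor.map_comp] at hl hl'
    exact ⟨⟨⟨l, addId_map_injective hl, addId_map_injective hl'⟩⟩⟩

end EnrSemicat

end Indicator

/-! ### The cofibrations pulled back from enriched categories -/

section Codiscrete

variable {V : Type u} [Category.{v} V] [CartesianMonoidalCategory V] {C : EnrCat.{w} V} {S : Type w}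

namespace EnrCat

/-- The enriched category with set of objects `S` all of whose spaces of maps are points. -/
def codiscrete (V : Type u) [Category.{v} V] [CartesianMonoidalCategory V] (S : Type w) :
    EnrCat.{w} V where
  Obj := S
  str :=
    { Hom := fun _ _ => 𝟙_ V
      id := fun _ => 𝟙 _
      comp := fun _ _ _ => toUnit _
      id_comp := fun _ _ => toUnit_unique _ _
      comp_id := fun _ _ => toUnit_unique _ _
      assoc := fun _ _ _ _ => toUnit_unique _ _ }

/-- The enriched functor to a codiscrete enriched category given by a map on objects. -/
def toCodiscrete (f : C.Obj → S) : C ⟶ codiscrete V S where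
  obj := f
  map _ _ := toUnit _
  map_id _ := toUnit_unique _ _
  map_comp _ _ _ := toUnit_unique _ _

theorem hom_codiscrete_ext {F G : C ⟶ codiscrete V S} (h : F.obj = G.obj) : F = G := by
  obtain ⟨o, _, _, _⟩ := F
  obtain ⟨o', _, _, _⟩ := G
  obtain rfl : o = o' := h
  exact enrichedFunctor_ext rfl <| heq_of_eq <| funext fun a => funext fun b => toUnit_unique _ _

end EnrCat

end Codiscrete

section InverseImage

variable {V : Type u} [Category.{v} V] [CartesianMonoidalCategory V] [MonoidalClosed V]
  [HasColimitsOfSize.{v, v} V] {ι : Type*} {s d : ι → V} (i : ∀ n, s n ⟶ d n)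
  {X Y : EnrSemicat.{w} V} {f : X ⟶ Y}

theorem injective_obj_of_llp_strictMap_addId
    (hf : ((globGens i).strictMap (addId V)).rlp.llp ((addId V).map f)) :
    Function.Injective f.obj := by
  let q : EnrCat.codiscrete V (ULift.{w} Prop) ⟶ EnrCat.codiscrete V PUnit.{w + 1} :=
    EnrCat.toCodiscrete fun _ => PUnit.unit
  have hq : ((globGens i).strictMap (addId V)).rlp q := by
    rw [rlp_strictMap_addId_iff, rlp_globGens_iff]
    refine ⟨fun _ => ⟨⟨True⟩, rfl⟩, fun n a b => ?_⟩
    have : ((forgetId V).map q).map a b = 𝟙 (𝟙_ V) := toUnit_unique _ _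
    exact this ▸ inferInstanceAs (HasLiftingProperty (i n) (𝟙 (𝟙_ V)))
  intro x y hxy
  have sq : CommSq (EnrCat.toCodiscrete (C := X.addIdObj) fun z => ⟨z = x⟩) ((addId V).map f) q
      (EnrCat.toCodiscrete fun _ => PUnit.unit) := ⟨EnrCat.hom_codiscrete_ext rfl⟩
  obtain ⟨⟨l, hl, -⟩⟩ := (hf q hq).sq_hasLift sq
  have h (z : X.Obj) : l.obj (f.obj z) = ⟨z = x⟩ := congrFun (congrArg EnrichedFunctor.obj hl) z
  have : (x = x) = (y = x) := congrArg ULift.down ((h x).symm.trans (hxy ▸ h y))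
  exact (this.mp rfl).symm

theorem inverseImage_addId_eq_llp_rlp (hV : HasEnoughPoints V) (hd : ∀ n, IsConnectedObject (d n)) :
    ((globGens i).strictMap (addId V)).rlp.llp.inverseImage (addId V) =
      (globGens.{w} i).rlp.llp := by
  refine le_antisymm (fun X Y f hf A B p hp => ?_) (llp_rlp_le_inverseImage_addId _)
  rw [rlp_globGens_iff] at hp
  have hpull : HasLiftingProperty f (B.toPull p) := by
    refine EnrSemicat.hasLiftingProperty_of_addId hV f _ (hf _ ?_)
    rw [rlp_strictMap_addId_iff, rlp_globGens_iff]
    exact ⟨Function.surjective_id, fun n a b =>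
      have : HasLiftingProperty (i n) ((B.toPull p).map a b) := hp.2 n a b
      EnrSemicat.hasLiftingProperty_idMap hV (i n) (hd n) (B.toPull p) Function.injective_id a b⟩
  have := EnrSemicat.hasLiftingProperty_pullι (B := B)
    (injective_obj_of_llp_strictMap_addId i hf) hp.1
  exact B.toPull_pullι p ▸ inferInstance

end InverseImage

/-! ### The small object argument in categories of diagrams -/

section SmallObject

open MorphismProperty

theorem hasLimitsOfSize_of_isLocallyPresentable (V : Type u) [Category.{v} V]
    [h : IsLocallyPresentable.{v} V] : HasLimitsOfSize.{v, v} V := by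
  obtain ⟨κ, _, _⟩ := h.exists_cardinal
  let F := (equivSmallModel.{v} (isCardinalPresentable V κ).FullSubcategory).inverse ⋙
    (isCardinalPresentable V κ).ι
  have : Reflective (Presheaf.restrictedULiftYoneda.{v} F) :=
    { L := _
      adj := Presheaf.uliftYonedaAdjunction (uliftYoneda.{v}.leftKanExtension F)
        (uliftYoneda.{v}.leftKanExtensionUnit F) }
  exact hasLimits_of_reflective (Presheaf.restrictedULiftYoneda.{v} F)

theorem isLocallyPresentable_functor (J : Type v) [SmallCategory J] (V : Type u) [Category.{v} V]
    [IsLocallyPresentable.{v} V] : IsLocallyPresentable.{v} (J ⥤ V) := by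
  have := hasLimitsOfSize_of_isLocallyPresentable V
  have := hasLimitsOfSizeShrink.{0, 0, v, v} V
  exact (opOpEquivalence J).congrLeft.isLocallyPresentable

theorem hasSmallObjectArgument_of_isLocallyPresentable {C : Type u} [Category.{v} C]
    [IsLocallyPresentable.{v} C] (I : MorphismProperty C) [IsSmall.{v} I] :
    HasSmallObjectArgument.{v} I := by
  choose κ _ hκ using fun i : I.toSet =>
    (inferInstance : IsPresentable.{v} i.1.left).exists_cardinal
  obtain ⟨κ', hreg, h⟩ := HasCardinalLT.exists_regular_cardinal_forall.{v}
    fun i => (κ i).ord.ToType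
  have hκ' (i : I.toSet) : κ i ≤ κ' := by
    simpa [hasCardinalLT_iff_cardinal_mk_lt] using (h i).le
  have : Fact κ'.IsRegular := ⟨hreg⟩
  have : Nonempty κ'.ord.ToType := by simpa using hreg.ne_zero
  have := WellFoundedLT.toOrderBot κ'.ord.ToType
  have := hasColimitsOfSizeShrink.{0, 0, v, v} C
  refine ⟨κ', inferInstance, inferInstance,
    { preservesColimit := fun {A B X Y} i hi f hf => ?_ }⟩
  have : IsCardinalPresentable A (κ ⟨Arrow.mk i, hi⟩) := hκ ⟨Arrow.mk i, hi⟩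
  have : IsCardinalPresentable A κ' := isCardinalPresentable_of_le _ (hκ' ⟨Arrow.mk i, hi⟩)
  have := preservesColimitsOfShape_of_isCardinalPresentable A κ' κ'.ord.ToType
  infer_instance

instance isSmall_sup {C : Type*} [Category* C] (W₁ W₂ : MorphismProperty C) [IsSmall.{w} W₁]
    [IsSmall.{w} W₂] : IsSmall.{w} (W₁ ⊔ W₂) where
  small_toSet := small_union W₁.toSet W₂.toSet

theorem rlp_sup_iff {C : Type*} [Category* C] (W₁ W₂ : MorphismProperty C) {X Y : C}
    (p : X ⟶ Y) : (W₁ ⊔ W₂).rlp p ↔ W₁.rlp p ∧ W₂.rlp p :=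
  ⟨fun h => ⟨fun _ _ f hf => h f (.inl hf), fun _ _ f hf => h f (.inr hf)⟩,
    fun h _ _ f hf => hf.elim (h.1 f) (h.2 f)⟩

theorem rlp_ofHoms_iff_forall {C : Type*} [Category* C] {ι : Type*} {s d : ι → C}
    (f : ∀ i, s i ⟶ d i) {X Y : C} (p : X ⟶ Y) :
    (ofHoms f).rlp p ↔ ∀ i, HasLiftingProperty (f i) p :=
  ⟨fun h i => h _ ⟨i⟩, by rintro h _ _ _ ⟨i⟩; exact h i⟩

theorem hasLiftingProperty_coequalizer_π_iff {C : Type*} [Category* C] {B E X Y : C}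
    (u v : B ⟶ E) [HasCoequalizer u v] (p : X ⟶ Y) :
    HasLiftingProperty (coequalizer.π u v) p ↔
      ∀ w : E ⟶ X, u ≫ w ≫ p = v ≫ w ≫ p → u ≫ w = v ≫ w := by
  constructor
  · intro _ w hw
    have sq : CommSq w (coequalizer.π u v) p (coequalizer.desc (w ≫ p) hw) :=
      ⟨(coequalizer.π_desc _ _).symm⟩
    rw [← sq.fac_left, coequalizer.condition_assoc]
  · refine fun h => ⟨fun {w y} sq => ?_⟩
    have hw : u ≫ w = v ≫ w := h w (by rw [sq.w, coequalizer.condition_assoc])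
    exact ⟨⟨⟨coequalizer.desc w hw, coequalizer.π_desc _ _,
      coequalizer.hom_ext (by rw [coequalizer.π_desc_assoc, sq.w])⟩⟩⟩

theorem hasLiftingProperty_coprod_desc_iff {C : Type*} [Category* C] {A A' B X Y : C}
    [HasBinaryCoproduct A A'] (f : A ⟶ B) (f' : A' ⟶ B) (p : X ⟶ Y) :
    HasLiftingProperty (coprod.desc f f') p ↔
      ∀ (y : B ⟶ Y) (x : A ⟶ X) (x' : A' ⟶ X), x ≫ p = f ≫ y → x' ≫ p = f' ≫ y →
        ∃ l : B ⟶ X, l ≫ p = y ∧ f ≫ l = x ∧ f' ≫ l = x' := by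
  constructor
  · intro _ y x x' hx hx'
    have sq : CommSq (coprod.desc x x') (coprod.desc f f') p y :=
      ⟨coprod.hom_ext (by rwa [coprod.inl_desc_assoc, coprod.inl_desc_assoc])
        (by rwa [coprod.inr_desc_assoc, coprod.inr_desc_assoc])⟩
    obtain ⟨⟨⟨l, hl, hl'⟩⟩⟩ : sq.HasLift := inferInstance
    exact ⟨l, hl', by rw [← coprod.inl_desc f f', Category.assoc, hl, coprod.inl_desc],
      by rw [← coprod.inr_desc f f', Category.assoc, hl, coprod.inr_desc]⟩
  · refine fun h => ⟨fun {x y} sq => ?_⟩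
    obtain ⟨l, hy, hx, hx'⟩ := h y (coprod.inl ≫ x) (coprod.inr ≫ x)
      (by rw [Category.assoc, sq.w, coprod.inl_desc_assoc])
      (by rw [Category.assoc, sq.w, coprod.inr_desc_assoc])
    exact ⟨⟨⟨l, coprod.hom_ext (by rw [coprod.inl_desc_assoc, hx])
      (by rw [coprod.inr_desc_assoc, hx']), hy⟩⟩⟩

end SmallObject

section Free

variable {J : Type v} [SmallCategory J] {V : Type u} [Category.{v} V] [HasColimitsOfSize.{v, v} V]

/-- The diagram freely generated by a `T`-point at `j`. -/
abbrev freeDiagram (j : J) (T : V) : J ⥤ V :=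
  (evaluationLeftAdjoint V j).obj T

/-- Maps out of a free diagram are `T`-points. -/
def freeHomEquiv {j : J} {T : V} {G : J ⥤ V} : (freeDiagram j T ⟶ G) ≃ (T ⟶ G.obj j) :=
  (evaluationAdjunctionRight V j).homEquiv T G

theorem freeHomEquiv_comp {j : J} {T : V} {G H : J ⥤ V} (f : freeDiagram j T ⟶ G) (p : G ⟶ H) :
    freeHomEquiv (f ≫ p) = freeHomEquiv f ≫ p.app j :=
  (evaluationAdjunctionRight V j).homEquiv_naturality_right f p

/-- The map of free diagrams corepresenting the action of a morphism of indices on `T`-points. -/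
def freeMap {j k : J} (φ : j ⟶ k) (T : V) : freeDiagram k T ⟶ freeDiagram j T :=
  freeHomEquiv.symm (freeHomEquiv (𝟙 _) ≫ (freeDiagram j T).map φ)

theorem freeHomEquiv_freeMap_comp {j k : J} (φ : j ⟶ k) {T : V} {G : J ⥤ V}
    (f : freeDiagram j T ⟶ G) : freeHomEquiv (freeMap φ T ≫ f) = freeHomEquiv f ≫ G.map φ := by
  rw [freeHomEquiv_comp, freeMap, Equiv.apply_symm_apply, Category.assoc, f.naturality,
    ← Category.assoc, ← freeHomEquiv_comp, Category.id_comp]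

theorem freeMap_comp_eq_iff {j j' k : J} {φ : j ⟶ k} {φ' : j' ⟶ k} {T : V} {G : J ⥤ V}
    {f : freeDiagram j T ⟶ G} {f' : freeDiagram j' T ⟶ G} :
    freeMap φ T ≫ f = freeMap φ' T ≫ f' ↔
      freeHomEquiv f ≫ G.map φ = freeHomEquiv f' ≫ G.map φ' := by
  rw [← freeHomEquiv.apply_eq_iff_eq, freeHomEquiv_freeMap_comp, freeHomEquiv_freeMap_comp]

end Free

/-! ### The Segal condition -/

/-- The shapes of the diagrams presenting a flow with set of states `S`: the spaces of execution
paths, and the spaces of pairs of composable execution paths. -/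
inductive FlowShape (S : Type v) : Type v
  | edge (a b : S) : FlowShape S
  | tri (a b c : S) : FlowShape S

namespace FlowShape

variable {S T : Type v}

/-- The faces of the shapes: `e01` and `e12` take a pair of composable execution paths to its
entries and `e02` takes it to its composite. -/
inductive Hom : FlowShape S → FlowShape S → Type v
  | id (x : FlowShape S) : Hom x x
  | e01 (a b c : S) : Hom (tri a b c) (edge a b)
  | e12 (a b c : S) : Hom (tri a b c) (edge b c)
  | e02 (a b c : S) : Hom (tri a b c) (edge a c)

/-- The composition of faces, of which at least one is an identity. -/
def Hom.comp : ∀ {x y z : FlowShape S}, Hom x y → Hom y z → Hom x z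
  | _, _, _, .id _, g => g
  | _, _, _, .e01 a b c, .id _ => .e01 a b c
  | _, _, _, .e12 a b c, .id _ => .e12 a b c
  | _, _, _, .e02 a b c, .id _ => .e02 a b c

instance : SmallCategory (FlowShape S) where
  Hom := Hom
  id := Hom.id
  comp := Hom.comp
  id_comp f := by cases f <;> rfl
  comp_id f := by cases f <;> rfl
  assoc f g h := by cases f <;> cases g <;> cases h <;> rfl

/-- The face `Hom.e01` as a morphism. -/
abbrev e01 (a b c : S) : tri a b c ⟶ edge a b := Hom.e01 a b c

/-- The face `Hom.e12` as a morphism. -/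
abbrev e12 (a b c : S) : tri a b c ⟶ edge b c := Hom.e12 a b c

/-- The face `Hom.e02` as a morphism. -/
abbrev e02 (a b c : S) : tri a b c ⟶ edge a c := Hom.e02 a b c

section MkFunctor

variable {C : Type*} [Category* C] {E : S → S → C} {P : S → S → S → C}
  (f01 : ∀ a b c, P a b c ⟶ E a b) (f12 : ∀ a b c, P a b c ⟶ E b c)
  (f02 : ∀ a b c, P a b c ⟶ E a c)

/-- A diagram given by its objects and its three families of faces. -/
@[reducible]
def mkFunctor : FlowShape S ⥤ C where
  obj
    | edge a b => E a b
    | tri a b c => P a b c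
  map {x y} f := match x, y, (f : Hom x y) with
    | _, _, .id _ => 𝟙 _
    | _, _, .e01 a b c => f01 a b c
    | _, _, .e12 a b c => f12 a b c
    | _, _, .e02 a b c => f02 a b c
  map_id _ := rfl
  map_comp {x y z} f g := match x, y, z, (f : Hom x y), (g : Hom y z) with
    | _, _, _, .id _, _ => (Category.id_comp _).symm
    | _, _, _, .e01 _ _ _, .id _ => (Category.comp_id _).symm
    | _, _, _, .e12 _ _ _, .id _ => (Category.comp_id _).symm
    | _, _, _, .e02 _ _ _, .id _ => (Category.comp_id _).symm

end MkFunctor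

/-- The functor between categories of shapes induced by a map of sets of states. -/
@[reducible]
def map (f : S → T) : FlowShape S ⥤ FlowShape T :=
  mkFunctor (fun a b c => e01 (f a) (f b) (f c)) (fun a b c => e12 (f a) (f b) (f c))
    fun a b c => e02 (f a) (f b) (f c)

end FlowShape

open FlowShape

section Segal

variable {V : Type u} [Category.{v} V] {S : Type v}

/-- The two ways of composing three composable execution paths in a diagram, parametrized by `T`:
`x012` composes the first two, `x023` composes the result with the third one, and similarly for
`x123` and `x013`. -/
@[ext]
structure Bracketing (G : FlowShape S ⥤ V) (a b c d : S) (T : V) where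
  x012 : T ⟶ G.obj (tri a b c)
  x023 : T ⟶ G.obj (tri a c d)
  x123 : T ⟶ G.obj (tri b c d)
  x013 : T ⟶ G.obj (tri a b d)
  face02 : x012 ≫ G.map (e02 a b c) = x023 ≫ G.map (e01 a c d)
  face13 : x123 ≫ G.map (e02 b c d) = x013 ≫ G.map (e12 a b d)
  face01 : x012 ≫ G.map (e01 a b c) = x013 ≫ G.map (e01 a b d)
  face12 : x012 ≫ G.map (e12 a b c) = x123 ≫ G.map (e01 b c d)
  face23 : x023 ≫ G.map (e12 a c d) = x123 ≫ G.map (e12 b c d)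

namespace Bracketing

variable {G H : FlowShape S ⥤ V} {a b c d : S} {T : V}

/-- The composite obtained by composing the first two paths first. -/
def left (β : Bracketing G a b c d T) : T ⟶ G.obj (edge a d) := β.x023 ≫ G.map (e02 a c d)

/-- The composite obtained by composing the last two paths first. -/
def right (β : Bracketing G a b c d T) : T ⟶ G.obj (edge a d) := β.x013 ≫ G.map (e02 a b d)

/-- The reparametrization of a bracketing. -/
@[simps]
def precomp {T' : V} (t : T' ⟶ T) (β : Bracketing G a b c d T) : Bracketing G a b c d T' where
  x012 := t ≫ β.x012
  x023 := t ≫ β.x023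
  x123 := t ≫ β.x123
  x013 := t ≫ β.x013
  face02 := by simp only [Category.assoc, β.face02]
  face13 := by simp only [Category.assoc, β.face13]
  face01 := by simp only [Category.assoc, β.face01]
  face12 := by simp only [Category.assoc, β.face12]
  face23 := by simp only [Category.assoc, β.face23]

/-- The image of a bracketing under a map of diagrams. -/
@[simps]
def map (p : G ⟶ H) (β : Bracketing G a b c d T) : Bracketing H a b c d T where
  x012 := β.x012 ≫ p.app _
  x023 := β.x023 ≫ p.app _
  x123 := β.x123 ≫ p.app _
  x013 := β.x013 ≫ p.app _
  face02 := by simp only [Category.assoc, ← p.naturality, reassoc_of% β.face02]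
  face13 := by simp only [Category.assoc, ← p.naturality, reassoc_of% β.face13]
  face01 := by simp only [Category.assoc, ← p.naturality, reassoc_of% β.face01]
  face12 := by simp only [Category.assoc, ← p.naturality, reassoc_of% β.face12]
  face23 := by simp only [Category.assoc, ← p.naturality, reassoc_of% β.face23]

theorem left_map (p : G ⟶ H) (β : Bracketing G a b c d T) :
    (β.map p).left = β.left ≫ p.app _ := by
  simp [left]

theorem right_map (p : G ⟶ H) (β : Bracketing G a b c d T) :
    (β.map p).right = β.right ≫ p.app _ := by
  simp [right]

end Bracketing

section Universal

variable [HasColimitsOfSize.{v, v} V]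

section Cells

variable (a b c d : S) (T : V)

/-- The map corepresenting the comparison `spine` on `T`-points. -/
def spineCell : freeDiagram (edge a b) T ⨿ freeDiagram (edge b c) T ⟶ freeDiagram (tri a b c) T :=
  coprod.desc (freeMap (e01 a b c) T) (freeMap (e12 a b c) T)

/-- The data of `x012` and `x023` in a universal bracketing. -/
abbrev leftHalf : FlowShape S ⥤ V :=
  pushout (freeMap (e02 a b c) T) (freeMap (e01 a c d) T)

/-- The data of `x123` and `x013` in a universal bracketing. -/
abbrev rightHalf : FlowShape S ⥤ V :=
  pushout (freeMap (e02 b c d) T) (freeMap (e12 a b d) T)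

/-- The three composable paths which are composed in a universal bracketing. -/
abbrev threePaths : FlowShape S ⥤ V :=
  freeDiagram (edge a b) T ⨿ (freeDiagram (edge b c) T ⨿ freeDiagram (edge c d) T)

/-- The inclusion of the three paths where the first two are composed first. -/
def threePathsLeft : threePaths a b c d T ⟶ leftHalf a b c d T :=
  coprod.desc (freeMap (e01 a b c) T ≫ pushout.inl _ _)
    (coprod.desc (freeMap (e12 a b c) T ≫ pushout.inl _ _)
      (freeMap (e12 a c d) T ≫ pushout.inr _ _))

/-- The inclusion of the three paths where the last two are composed first. -/
def threePathsRight : threePaths a b c d T ⟶ rightHalf a b c d T :=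
  coprod.desc (freeMap (e01 a b d) T ≫ pushout.inr _ _)
    (coprod.desc (freeMap (e01 b c d) T ≫ pushout.inl _ _)
      (freeMap (e12 b c d) T ≫ pushout.inl _ _))

variable {a b c d T} in
theorem threePaths_comp_eq_iff {G : FlowShape S ⥤ V} {l : leftHalf a b c d T ⟶ G}
    {r : rightHalf a b c d T ⟶ G} :
    threePathsLeft a b c d T ≫ l = threePathsRight a b c d T ≫ r ↔
      freeMap (e01 a b c) T ≫ pushout.inl _ _ ≫ l = freeMap (e01 a b d) T ≫ pushout.inr _ _ ≫ r ∧
      freeMap (e12 a b c) T ≫ pushout.inl _ _ ≫ l = freeMap (e01 b c d) T ≫ pushout.inl _ _ ≫ r ∧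
      freeMap (e12 a c d) T ≫ pushout.inr _ _ ≫ l =
        freeMap (e12 b c d) T ≫ pushout.inl _ _ ≫ r := by
  simp only [threePathsLeft, threePathsRight, coprod.hom_ext_iff, coprod.inl_desc_assoc,
    coprod.inr_desc_assoc, Category.assoc]

/-- The diagram freely generated by a bracketing parametrized by `T`. -/
abbrev freeBracketing : FlowShape S ⥤ V :=
  pushout (threePathsLeft a b c d T) (threePathsRight a b c d T)

/-- The map corepresenting `Bracketing.left`. -/
def freeLeft : freeDiagram (edge a d) T ⟶ freeBracketing a b c d T :=
  freeMap (e02 a c d) T ≫ pushout.inr _ _ ≫ pushout.inl _ _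

/-- The map corepresenting `Bracketing.right`. -/
def freeRight : freeDiagram (edge a d) T ⟶ freeBracketing a b c d T :=
  freeMap (e02 a b d) T ≫ pushout.inr _ _ ≫ pushout.inr _ _

end Cells

namespace Bracketing

variable {G : FlowShape S ⥤ V} {a b c d : S} {T : V}

/-- The bracketing classified by a map out of a universal bracketing. -/
def ofHom (w : freeBracketing a b c d T ⟶ G) : Bracketing G a b c d T where
  x012 := freeHomEquiv (pushout.inl _ _ ≫ pushout.inl _ _ ≫ w)
  x023 := freeHomEquiv (pushout.inr _ _ ≫ pushout.inl _ _ ≫ w)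
  x123 := freeHomEquiv (pushout.inl _ _ ≫ pushout.inr _ _ ≫ w)
  x013 := freeHomEquiv (pushout.inr _ _ ≫ pushout.inr _ _ ≫ w)
  face02 := freeMap_comp_eq_iff.1 (pushout.condition_assoc _)
  face13 := freeMap_comp_eq_iff.1 (pushout.condition_assoc _)
  face01 := freeMap_comp_eq_iff.1 (threePaths_comp_eq_iff.1 (pushout.condition_assoc w)).1
  face12 := freeMap_comp_eq_iff.1 (threePaths_comp_eq_iff.1 (pushout.condition_assoc w)).2.1
  face23 := freeMap_comp_eq_iff.1 (threePaths_comp_eq_iff.1 (pushout.condition_assoc w)).2.2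

theorem left_ofHom (w : freeBracketing a b c d T ⟶ G) :
    (ofHom w).left = freeHomEquiv (freeLeft a b c d T ≫ w) := by
  rw [freeLeft, Category.assoc, freeHomEquiv_freeMap_comp, Category.assoc]
  rfl

theorem right_ofHom (w : freeBracketing a b c d T ⟶ G) :
    (ofHom w).right = freeHomEquiv (freeRight a b c d T ≫ w) := by
  rw [freeRight, Category.assoc, freeHomEquiv_freeMap_comp, Category.assoc]
  rfl

theorem exists_ofHom_eq (β : Bracketing G a b c d T) : ∃ w, ofHom w = β := by
  have freeMap_comp {j j' k : FlowShape S} {φ : j ⟶ k} {φ' : j' ⟶ k} {x : T ⟶ G.obj j}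
      {x' : T ⟶ G.obj j'} (h : x ≫ G.map φ = x' ≫ G.map φ') :
      freeMap φ T ≫ freeHomEquiv.symm x = freeMap φ' T ≫ freeHomEquiv.symm x' :=
    freeMap_comp_eq_iff.2 (by simpa using h)
  let l : leftHalf a b c d T ⟶ G := pushout.desc _ _ (freeMap_comp β.face02)
  let r : rightHalf a b c d T ⟶ G := pushout.desc _ _ (freeMap_comp β.face13)
  have hlr : threePathsLeft a b c d T ≫ l = threePathsRight a b c d T ≫ r :=
    threePaths_comp_eq_iff.2 (by
      simpa only [l, r, pushout.inl_desc, pushout.inr_desc] using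
        ⟨freeMap_comp β.face01, freeMap_comp β.face12, freeMap_comp β.face23⟩)
  exact ⟨pushout.desc l r hlr, by
    ext <;> simp [ofHom, l, r, pushout.inl_desc, pushout.inr_desc]⟩

end Bracketing

end Universal

variable [CartesianMonoidalCategory V]

/-- The comparison of the pairs of composable execution paths prescribed by a diagram with actual
pairs. -/
abbrev spine (G : FlowShape S ⥤ V) (a b c : S) :
    G.obj (tri a b c) ⟶ G.obj (edge a b) ⊗ G.obj (edge b c) :=
  lift (G.map (e01 a b c)) (G.map (e12 a b c))

theorem comp_spine_eq_iff {G : FlowShape S ⥤ V} {a b c : S} {T : V}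
    {z z' : T ⟶ G.obj (tri a b c)} :
    z ≫ spine G a b c = z' ≫ spine G a b c ↔
      z ≫ G.map (e01 a b c) = z' ≫ G.map (e01 a b c) ∧
        z ≫ G.map (e12 a b c) = z' ≫ G.map (e12 a b c) := by
  rw [comp_lift, comp_lift]
  exact ⟨fun h => ⟨by simpa using h =≫ fst _ _, by simpa using h =≫ snd _ _⟩,
    fun h => by rw [h.1, h.2]⟩

/-- A diagram satisfies the Segal condition when it presents a flow: the pairs of composable
execution paths are the expected ones and the composition is associative. -/
structure IsSegal (G : FlowShape S ⥤ V) : Prop where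
  isIso_spine (a b c : S) : IsIso (spine G a b c)
  left_eq_right {a b c d : S} {T : V} (β : Bracketing G a b c d T) : β.left = β.right

end Segal

section Cells

open MorphismProperty

variable {V : Type u} [Category.{v} V] {S : Type v} [HasColimitsOfSize.{v, v} V]
  (Q : ObjectProperty V) {ι : Type w} {s d : ι → V} (i : ∀ n, s n ⟶ d n)

/-- The cells freely attaching a map of the family `i` to the execution paths from `a` to `b`. -/
def edgeCell (x : ι × S × S) : freeDiagram (edge x.2.1 x.2.2) (s x.1) ⟶
    freeDiagram (edge x.2.1 x.2.2) (d x.1) :=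
  (evaluationLeftAdjoint V (edge x.2.1 x.2.2)).map (i x.1)

variable (S) in
/-- The cells forcing the Segal condition on a diagram: they add composable pairs, identify the
composable pairs with the same entries, and identify the two composites of three paths. Only the
points parametrized by the objects satisfying `Q` are tested. -/
def segalCells : MorphismProperty (FlowShape S ⥤ V) :=
  ofHoms (fun x : Subtype Q × S × S × S => spineCell x.2.1 x.2.2.1 x.2.2.2 x.1.1) ⊔
    (ofHoms (fun x : Subtype Q × S × S × S =>
      coequalizer.π (pushout.inl (spineCell x.2.1 x.2.2.1 x.2.2.2 x.1.1) (spineCell _ _ _ _))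
        (pushout.inr _ _)) ⊔
    ofHoms fun x : Subtype Q × S × S × S × S =>
      coequalizer.π (freeLeft x.2.1 x.2.2.1 x.2.2.2.1 x.2.2.2.2 x.1.1) (freeRight _ _ _ _ _))

variable (S) in
/-- The cells generating the maps of diagrams over a flow whose source is a flow and which have
the right lifting property with respect to the family `i` on execution paths. -/
def flowCells : MorphismProperty (FlowShape S ⥤ V) :=
  ofHoms (edgeCell i (S := S)) ⊔ segalCells S Q

theorem isSmall_flowCells [Small.{v} ι] [ObjectProperty.Small.{v} Q] :
    IsSmall.{v} (flowCells S Q i) := by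
  have : Small.{v} (Subtype Q) := inferInstanceAs (ObjectProperty.Small.{v} Q)
  have h₁ : IsSmall.{v} (segalCells S Q) := by
    unfold segalCells
    infer_instance
  unfold flowCells
  infer_instance

theorem rlp_edgeCells_iff {G H : FlowShape S ⥤ V} (p : G ⟶ H) :
    (ofHoms (edgeCell i (S := S))).rlp p ↔
      ∀ n a b, HasLiftingProperty (i n) (p.app (edge a b)) := by
  rw [rlp_ofHoms_iff_forall]
  have key (x : ι × S × S) :=
    (evaluationAdjunctionRight V (edge x.2.1 x.2.2)).hasLiftingProperty_iff (i x.1) p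
  exact ⟨fun h n a b => (key ⟨n, a, b⟩).1 (h ⟨n, a, b⟩), fun h x => (key x).2 (h _ _ _)⟩

variable {G H : FlowShape S ⥤ V} (p : G ⟶ H) (a b c d : S) (T : V)

theorem hasLiftingProperty_spineCell_iff :
    HasLiftingProperty (spineCell a b c T) p ↔
      ∀ (y : T ⟶ H.obj (tri a b c)) (x : T ⟶ G.obj (edge a b)) (x' : T ⟶ G.obj (edge b c)),
        x ≫ p.app _ = y ≫ H.map (e01 a b c) → x' ≫ p.app _ = y ≫ H.map (e12 a b c) →
          ∃ z : T ⟶ G.obj (tri a b c), z ≫ p.app _ = y ∧ z ≫ G.map (e01 a b c) = x ∧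
            z ≫ G.map (e12 a b c) = x' := by
  rw [spineCell, hasLiftingProperty_coprod_desc_iff]
  simp only [← freeHomEquiv.forall_congr_right, ← freeHomEquiv.exists_congr_right,
    ← freeHomEquiv_comp, ← freeHomEquiv_freeMap_comp, freeHomEquiv.apply_eq_iff_eq]

theorem spineCell_comp_eq_iff (w w' : freeDiagram (tri a b c) T ⟶ G) :
    spineCell a b c T ≫ w = spineCell a b c T ≫ w' ↔
      freeHomEquiv w ≫ G.map (e01 a b c) = freeHomEquiv w' ≫ G.map (e01 a b c) ∧
        freeHomEquiv w ≫ G.map (e12 a b c) = freeHomEquiv w' ≫ G.map (e12 a b c) := by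
  rw [← freeMap_comp_eq_iff, ← freeMap_comp_eq_iff, spineCell, coprod.hom_ext_iff]
  simp only [coprod.inl_desc_assoc, coprod.inr_desc_assoc]

theorem hasLiftingProperty_uniquenessCell_iff :
    HasLiftingProperty (coequalizer.π (pushout.inl (spineCell a b c T) (spineCell a b c T))
      (pushout.inr _ _)) p ↔
      ∀ z z' : T ⟶ G.obj (tri a b c), z ≫ G.map (e01 a b c) = z' ≫ G.map (e01 a b c) →
        z ≫ G.map (e12 a b c) = z' ≫ G.map (e12 a b c) → z ≫ p.app _ = z' ≫ p.app _ →
          z = z' := by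
  rw [hasLiftingProperty_coequalizer_π_iff]
  constructor
  · intro h z z' h₁ h₂ hp
    have hw : spineCell a b c T ≫ freeHomEquiv.symm z = spineCell a b c T ≫ freeHomEquiv.symm z' :=
      (spineCell_comp_eq_iff _ _ _ _ _ _).2 (by simpa using ⟨h₁, h₂⟩)
    have := h (pushout.desc _ _ hw)
    rw [pushout.inl_desc_assoc, pushout.inr_desc_assoc, pushout.inl_desc, pushout.inr_desc] at this
    refine freeHomEquiv.symm.injective (this ?_)
    rw [← freeHomEquiv.apply_eq_iff_eq]
    simpa [freeHomEquiv_comp] using hp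
  · intro h w hw
    have hs := (spineCell_comp_eq_iff _ _ _ _ _ _).1 (pushout.condition_assoc w)
    refine freeHomEquiv.injective (h _ _ hs.1 hs.2 ?_)
    simpa [freeHomEquiv_comp] using congrArg freeHomEquiv hw

theorem hasLiftingProperty_associativityCell_iff :
    HasLiftingProperty (coequalizer.π (freeLeft a b c d T) (freeRight a b c d T)) p ↔
      ∀ β : Bracketing G a b c d T, (β.map p).left = (β.map p).right → β.left = β.right := by
  rw [hasLiftingProperty_coequalizer_π_iff]
  simp only [Bracketing.left_map, Bracketing.right_map]
  constructor
  · intro h β hβ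
    obtain ⟨w, rfl⟩ := β.exists_ofHom_eq
    simp only [Bracketing.left_ofHom, Bracketing.right_ofHom, ← freeHomEquiv_comp,
      freeHomEquiv.apply_eq_iff_eq, Category.assoc] at hβ ⊢
    exact h w hβ
  · intro h w hw
    have := h (.ofHom w)
    simp only [Bracketing.left_ofHom, Bracketing.right_ofHom, ← freeHomEquiv_comp,
      freeHomEquiv.apply_eq_iff_eq, Category.assoc] at this
    exact this hw

end Cells

namespace IsSegal

variable {V : Type u} [Category.{v} V] [CartesianMonoidalCategory V] {S : Type v}
  {G : FlowShape S ⥤ V} {a b c : S} {T : V}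

theorem tri_hom_ext (hG : IsSegal G) {z z' : T ⟶ G.obj (tri a b c)}
    (h₁ : z ≫ G.map (e01 a b c) = z' ≫ G.map (e01 a b c))
    (h₂ : z ≫ G.map (e12 a b c) = z' ≫ G.map (e12 a b c)) : z = z' := by
  have := hG.isIso_spine a b c
  rw [← cancel_mono (spine G a b c), comp_spine_eq_iff]
  exact ⟨h₁, h₂⟩

theorem exists_tri (hG : IsSegal G) (x : T ⟶ G.obj (edge a b)) (x' : T ⟶ G.obj (edge b c)) :
    ∃ z : T ⟶ G.obj (tri a b c), z ≫ G.map (e01 a b c) = x ∧ z ≫ G.map (e12 a b c) = x' := by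
  have := hG.isIso_spine a b c
  have hz : (lift x x' ≫ inv (spine G a b c)) ≫ spine G a b c = lift x x' := by
    rw [Category.assoc, IsIso.inv_hom_id, Category.comp_id]
  exact ⟨lift x x' ≫ inv (spine G a b c), by simpa using hz =≫ fst _ _,
    by simpa using hz =≫ snd _ _⟩

end IsSegal

section Recognition

open MorphismProperty

variable {V : Type u} [Category.{v} V] [CartesianMonoidalCategory V] {S : Type v}
  [HasColimitsOfSize.{v, v} V] {Q : ObjectProperty V} {G H : FlowShape S ⥤ V}

theorem isIso_spine_of_hasLiftingProperty (hQ : Q.IsStrongGenerator) (hH : IsSegal H) (p : G ⟶ H)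
    {a b c : S} (hs : ∀ T, Q T → HasLiftingProperty (spineCell a b c T) p)
    (hu : ∀ T, Q T → HasLiftingProperty (coequalizer.π
      (pushout.inl (spineCell a b c T) (spineCell a b c T)) (pushout.inr _ _)) p) :
    IsIso (spine G a b c) := by
  have : Mono (spine G a b c) := by
    rw [hQ.isSeparating.mono_iff]
    intro T hT z z' hz
    obtain ⟨h₁, h₂⟩ := comp_spine_eq_iff.1 hz
    refine (hasLiftingProperty_uniquenessCell_iff p a b c T).1 (hu T hT) z z' h₁ h₂ ?_
    exact hH.tri_hom_ext (by simp only [Category.assoc, ← p.naturality, reassoc_of% h₁])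
      (by simp only [Category.assoc, ← p.naturality, reassoc_of% h₂])
  refine hQ.isIso_of_mono _ fun T hT y => ?_
  obtain ⟨t, h₁, h₂⟩ := hH.exists_tri ((y ≫ fst _ _) ≫ p.app _) ((y ≫ snd _ _) ≫ p.app _)
  obtain ⟨z, -, hz₁, hz₂⟩ := (hasLiftingProperty_spineCell_iff p a b c T).1 (hs T hT) t
    (y ≫ fst _ _) (y ≫ snd _ _) h₁.symm h₂.symm
  exact ⟨z, CartesianMonoidalCategory.hom_ext _ _ (by simpa using hz₁) (by simpa using hz₂)⟩

theorem rlp_segalCells_iff (hQ : Q.IsStrongGenerator) (hH : IsSegal H) (p : G ⟶ H) :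
    (segalCells S Q).rlp p ↔ IsSegal G := by
  simp only [segalCells, rlp_sup_iff, rlp_ofHoms_iff_forall, Prod.forall, Subtype.forall]
  constructor
  · rintro ⟨hs, hu, ha⟩
    refine ⟨fun a b c => isIso_spine_of_hasLiftingProperty hQ hH p (fun T hT => hs T hT a b c)
      fun T hT => hu T hT a b c, fun {a b c d} T β => hQ.isSeparating _ _ fun T' hT' t => ?_⟩
    have hlr := (hasLiftingProperty_associativityCell_iff p a b c d T').1 (ha T' hT' a b c d)
      (β.precomp t) (hH.left_eq_right _)
    simpa [Bracketing.left, Bracketing.right] using hlr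
  · intro hG
    refine ⟨fun T _ a b c => ?_, fun T _ a b c => ?_, fun T _ a b c d => ?_⟩
    · refine (hasLiftingProperty_spineCell_iff p a b c T).2 fun y x x' hx hx' => ?_
      obtain ⟨z, hz, hz'⟩ := hG.exists_tri x x'
      exact ⟨z, hH.tri_hom_ext
        (by rw [Category.assoc, ← p.naturality, reassoc_of% hz, hx])
        (by rw [Category.assoc, ← p.naturality, reassoc_of% hz', hx']), hz, hz'⟩
    · exact (hasLiftingProperty_uniquenessCell_iff p a b c T).2
        fun z z' h₁ h₂ _ => hG.tri_hom_ext h₁ h₂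
    · exact (hasLiftingProperty_associativityCell_iff p a b c d T).2
        fun β _ => hG.left_eq_right β

theorem rlp_flowCells_iff {ι : Type w} {s d : ι → V} (i : ∀ n, s n ⟶ d n)
    (hQ : Q.IsStrongGenerator) (hH : IsSegal H) (p : G ⟶ H) :
    (flowCells S Q i).rlp p ↔
      (∀ n a b, HasLiftingProperty (i n) (p.app (edge a b))) ∧ IsSegal G := by
  rw [flowCells, rlp_sup_iff, rlp_edgeCells_iff, rlp_segalCells_iff hQ hH]

end Recognition

namespace IsSegal

variable {V : Type u} [Category.{v} V] [CartesianMonoidalCategory V] {R S : Type v}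
  {G H : FlowShape S ⥤ V} {a b c d : S} {T : V}

/-- The composition of the execution paths in a diagram satisfying the Segal condition. -/
def comp (hG : IsSegal G) (a b c : S) :
    G.obj (edge a b) ⊗ G.obj (edge b c) ⟶ G.obj (edge a c) :=
  have := hG.isIso_spine a b c
  inv (spine G a b c) ≫ G.map (e02 a b c)

theorem spine_comp (hG : IsSegal G) (a b c : S) :
    spine G a b c ≫ hG.comp a b c = G.map (e02 a b c) := by
  have := hG.isIso_spine a b c
  exact IsIso.hom_inv_id_assoc _ _

theorem lift_comp (hG : IsSegal G) (z : T ⟶ G.obj (tri a b c)) :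
    lift (z ≫ G.map (e01 a b c)) (z ≫ G.map (e12 a b c)) ≫ hG.comp a b c =
      z ≫ G.map (e02 a b c) := by
  rw [← comp_lift, Category.assoc, hG.spine_comp]

theorem comp_assoc (hG : IsSegal G) (a b c d : S) :
    hG.comp a b c ▷ G.obj (edge c d) ≫ hG.comp a c d =
      (α_ (G.obj (edge a b)) (G.obj (edge b c)) (G.obj (edge c d))).hom ≫
        G.obj (edge a b) ◁ hG.comp b c d ≫ hG.comp a b d := by
  let T := (G.obj (edge a b) ⊗ G.obj (edge b c)) ⊗ G.obj (edge c d)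
  let x₁ : T ⟶ G.obj (edge a b) := fst _ _ ≫ fst _ _
  let x₂ : T ⟶ G.obj (edge b c) := fst _ _ ≫ snd _ _
  let x₃ : T ⟶ G.obj (edge c d) := snd _ _
  obtain ⟨x012, h₁, h₂⟩ := hG.exists_tri x₁ x₂
  obtain ⟨x123, h₂', h₃⟩ := hG.exists_tri x₂ x₃
  obtain ⟨x023, h₁₂, h₃'⟩ := hG.exists_tri (x012 ≫ G.map (e02 a b c)) x₃
  obtain ⟨x013, h₁', h₂₃⟩ := hG.exists_tri x₁ (x123 ≫ G.map (e02 b c d))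
  have hlr : x023 ≫ G.map (e02 a c d) = x013 ≫ G.map (e02 a b d) :=
    hG.left_eq_right ⟨x012, x023, x123, x013, h₁₂.symm, h₂₃.symm, h₁.trans h₁'.symm,
      h₂.trans h₂'.symm, h₃'.trans h₃.symm⟩
  rw [← hG.lift_comp, ← hG.lift_comp, h₁₂, h₂₃, h₁', h₃', ← hG.lift_comp, ← hG.lift_comp,
    h₁, h₂, h₂', h₃] at hlr
  calc
    _ = lift (lift x₁ x₂ ≫ hG.comp a b c) x₃ ≫ hG.comp a c d := by
      congr 1
      ext <;> simp [x₁, x₂, x₃]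
    _ = lift x₁ (lift x₂ x₃ ≫ hG.comp b c d) ≫ hG.comp a b d := hlr
    _ = _ := by
      have h₂₃ : lift x₂ x₃ = (α_ _ _ _).hom ≫ snd _ _ := by ext <;> simp [x₂, x₃]
      rw [h₂₃, ← Category.assoc]
      congr 1
      ext <;> simp [x₁]

/-- The flow presented by a diagram satisfying the Segal condition. -/
@[reducible]
def flow (hG : IsSegal G) : EnrSemicat.{v} V where
  Obj := S
  Path a b := G.obj (edge a b)
  comp := hG.comp
  assoc := hG.comp_assoc

theorem restrict (hG : IsSegal G) (g : R → S) : IsSegal (FlowShape.map g ⋙ G) where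
  isIso_spine a b c := hG.isIso_spine (g a) (g b) (g c)
  left_eq_right β := hG.left_eq_right
    ⟨β.x012, β.x023, β.x123, β.x013, β.face02, β.face13, β.face01, β.face12, β.face23⟩

theorem hom_ext (hH : IsSegal H) {α β : G ⟶ H}
    (h : ∀ a b, α.app (edge a b) = β.app (edge a b)) : α = β := by
  ext x
  cases x with
  | edge a b => exact h a b
  | tri a b c =>
    apply hH.tri_hom_ext
    · rw [← α.naturality, ← β.naturality, h]
    · rw [← α.naturality, ← β.naturality, h]

theorem comp_app (hG : IsSegal G) (hH : IsSegal H) (α : G ⟶ H) (a b c : S) :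
    hG.comp a b c ≫ α.app (edge a c) =
      (α.app (edge a b) ⊗ₘ α.app (edge b c)) ≫ hH.comp a b c := by
  have := hG.isIso_spine a b c
  rw [← cancel_epi (spine G a b c), ← Category.assoc, hG.spine_comp, α.naturality, ← hH.lift_comp,
    ← α.naturality, ← α.naturality, lift_map_assoc]

/-- A map of diagrams satisfying the Segal condition is a multiplicative family of maps between the
spaces of execution paths. -/
def homMk (hG : IsSegal G) (hH : IsSegal H) (g : ∀ a b, G.obj (edge a b) ⟶ H.obj (edge a b))
    (hg : ∀ a b c, hG.comp a b c ≫ g a c = (g a b ⊗ₘ g b c) ≫ hH.comp a b c) : G ⟶ H where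
  app
    | edge a b => g a b
    | tri a b c =>
      have := hH.isIso_spine a b c
      spine G a b c ≫ (g a b ⊗ₘ g b c) ≫ inv (spine H a b c)
  naturality x y φ := match x, y, (φ : Hom x y) with
    | _, _, .id _ => by
      exact (congrArg (· ≫ _) (G.map_id _)).trans ((Category.id_comp _).trans
        ((Category.comp_id _).symm.trans (congrArg (_ ≫ ·) (H.map_id _)).symm))
    | _, _, .e01 a b c => by
      have := hH.isIso_spine a b c
      have h : inv (spine H a b c) ≫ H.map (e01 a b c) = fst _ _ := by simp [spine]
      exact (by simp [h, spine] : G.map (e01 a b c) ≫ g a b =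
        (spine G a b c ≫ (g a b ⊗ₘ g b c) ≫ inv (spine H a b c)) ≫ H.map (e01 a b c))
    | _, _, .e12 a b c => by
      have := hH.isIso_spine a b c
      have h : inv (spine H a b c) ≫ H.map (e12 a b c) = snd _ _ := by simp [spine]
      exact (by simp [h, spine] : G.map (e12 a b c) ≫ g b c =
        (spine G a b c ≫ (g a b ⊗ₘ g b c) ≫ inv (spine H a b c)) ≫ H.map (e12 a b c))
    | _, _, .e02 a b c => by
      have := hH.isIso_spine a b c
      have h : inv (spine H a b c) ≫ H.map (e02 a b c) = hH.comp a b c := rfl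
      exact (by simp only [Category.assoc, h, ← hg, ← hG.spine_comp] :
        G.map (e02 a b c) ≫ g a c =
          (spine G a b c ≫ (g a b ⊗ₘ g b c) ≫ inv (spine H a b c)) ≫ H.map (e02 a b c))

/-- The map of flows presented by a map of diagrams. -/
def hom {H : FlowShape R ⥤ V} (hG : IsSegal G) (hH : IsSegal H) (g : S → R)
    (γ : G ⟶ FlowShape.map g ⋙ H) : hG.flow ⟶ hH.flow where
  obj := g
  map a b := γ.app (edge a b)
  map_comp := hG.comp_app (hH.restrict g) γ

end IsSegal

namespace EnrSemicat

variable {V : Type u} [Category.{v} V] [CartesianMonoidalCategory V] (A : EnrSemicat.{v} V)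

/-- The diagram of execution paths and of pairs of composable execution paths of a flow. -/
@[reducible]
def nerve : FlowShape A.Obj ⥤ V :=
  mkFunctor (fun a b c => fst (A.Path a b) (A.Path b c))
    (fun a b c => snd (A.Path a b) (A.Path b c)) A.comp

theorem isSegal_nerve : IsSegal A.nerve where
  isIso_spine a b c := by
    have : spine A.nerve a b c = 𝟙 (A.Path a b ⊗ A.Path b c) := lift_fst_snd
    rw [this]
    infer_instance
  left_eq_right {a b c d T} β := by
    let t : T ⟶ (A.Path a b ⊗ A.Path b c) ⊗ A.Path c d :=
      lift β.x012 (β.x123 ≫ snd (A.Path b c) (A.Path c d))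
    have h023 : β.x023 = t ≫ A.comp a b c ▷ A.Path c d :=
      CartesianMonoidalCategory.hom_ext (X := A.Path a c) (Y := A.Path c d) _ _
        (β.face02.symm.trans (by simp [t])) (β.face23.trans (by simp [t]))
    have h123 : β.x123 = t ≫ (α_ _ _ _).hom ≫ snd _ _ :=
      CartesianMonoidalCategory.hom_ext (X := A.Path b c) (Y := A.Path c d) _ _
        (β.face12.symm.trans (by simp [t])) (by simp [t])
    have h013 : β.x013 = t ≫ (α_ _ _ _).hom ≫ A.Path a b ◁ A.comp b c d :=
      CartesianMonoidalCategory.hom_ext (X := A.Path a b) (Y := A.Path b d) _ _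
        (β.face01.symm.trans (by simp [t])) (β.face13.symm.trans (by
          rw [h123, Category.assoc, Category.assoc, Category.assoc, Category.assoc,
            whiskerLeft_snd]))
    exact (congrArg (· ≫ A.comp a c d) h023).trans <| (Category.assoc _ _ _).trans <|
      (congrArg (t ≫ ·) (A.assoc a b c d)).trans <|
      ((congrArg (· ≫ A.comp a b d) h013).trans (by simp)).symm

theorem exists_flow_eq : ∃ (S : Type v) (G : FlowShape S ⥤ V) (hG : IsSegal G), hG.flow = A := by
  refine ⟨A.Obj, A.nerve, A.isSegal_nerve, ?_⟩
  have hcomp (a b c : A.Obj) : A.isSegal_nerve.comp a b c = A.comp a b c :=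
    (Category.id_comp _).symm.trans ((congrArg (· ≫ _) lift_fst_snd.symm).trans
      (A.isSegal_nerve.spine_comp a b c))
  obtain ⟨Obj, Path, comp, assoc⟩ := A
  rw [EnrSemicat.mk.injEq]
  exact ⟨rfl, HEq.rfl, heq_of_eq (funext fun a => funext fun b => funext (hcomp a b))⟩

end EnrSemicat

/-! ### Factorizations of maps of flows -/

section Factorization

variable {V : Type u} [Category.{v} V] [IsLocallyPresentable.{v} V]

theorem exists_small_isStrongGenerator (V : Type u) [Category.{v} V]
    [IsLocallyPresentable.{v} V] :
    ∃ (Q : ObjectProperty V) (_ : ObjectProperty.Small.{v} Q), Q.IsStrongGenerator := by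
  obtain ⟨κ, _, _⟩ := IsLocallyPresentable.exists_cardinal.{v} V
  obtain ⟨Q, _, hQ⟩ := HasCardinalFilteredGenerator.exists_small_generator V κ
  exact ⟨Q, inferInstance, hQ.isStrongGenerator⟩

variable {Q : ObjectProperty V} {ι : Type*} {s d : ι → V} (i : ∀ n, s n ⟶ d n)

theorem hasFactorization_flowCells (Q : ObjectProperty V) [Small.{v} ι]
    [ObjectProperty.Small.{v} Q] (S : Type v) :
    (flowCells S Q i).rlp.llp.HasFactorization (flowCells S Q i).rlp := by
  have := isSmall_flowCells Q i (S := S)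
  have := isLocallyPresentable_functor (FlowShape S) V
  have := hasSmallObjectArgument_of_isLocallyPresentable (flowCells S Q i)
  infer_instance

variable [CartesianMonoidalCategory V]

namespace IsSegal

variable {R S : Type v} {K : FlowShape R ⥤ V} {G A B : FlowShape S ⥤ V}

/-- The map of flows presented by a map out of a left Kan extension. -/
def homOfLan (hK : IsSegal K) (hG : IsSegal G) (g : R → S)
    (l : (FlowShape.map g).lan.obj K ⟶ G) : hK.flow ⟶ hG.flow :=
  hK.hom hG g (((FlowShape.map g).lanAdjunction V).homEquiv K G l)

theorem homOfLan_comp {T : Type v} {H : FlowShape T ⥤ V} (hK : IsSegal K) (hG : IsSegal G)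
    (hH : IsSegal H) (g : R → S) (h : S → T) (l : (FlowShape.map g).lan.obj K ⟶ G)
    (r : G ⟶ FlowShape.map h ⋙ H) (a b : R) :
    (hK.homOfLan hG g l ≫ hG.hom hH h r).map a b =
      (hK.homOfLan (hH.restrict h) g (l ≫ r)).map a b :=
  (NatTrans.congr_app (((FlowShape.map g).lanAdjunction V).homEquiv_naturality_right l r)
    (edge a b)).symm

/-- The map of flows which is the identity on states and is presented by a map of diagrams. -/
def flowMap (hA : IsSegal A) (hB : IsSegal B) (π : A ⟶ B) : hA.flow ⟶ hB.flow where
  obj a := a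
  map a b := π.app (edge a b)
  map_comp := hA.comp_app hB π

theorem hasLiftingProperty_flowMap {T : Type v} {A B : FlowShape T ⥤ V} (hQ : Q.IsStrongGenerator)
    (hK : IsSegal K) (hG : IsSegal G) (hA : IsSegal A) (hB : IsSegal B) {g : R → S}
    {l : (FlowShape.map g).lan.obj K ⟶ G} (hl : (flowCells S Q i).rlp.llp l) {π : A ⟶ B}
    (hπ : ∀ n a b, HasLiftingProperty (i n) (π.app (edge a b))) :
    HasLiftingProperty (hK.homOfLan hG g l) (hA.flowMap hB π) where
  sq_hasLift {x y} sq := by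
    obtain ⟨h, y, hy⟩ := y
    obtain ⟨xo, x, hx⟩ := x
    obtain rfl : xo = fun a => h (g a) := funext (EnrSemicat.congr_obj sq.w)
    let adj := (FlowShape.map g).lanAdjunction V
    let μ : K ⟶ FlowShape.map g ⋙ FlowShape.map h ⋙ A :=
      hK.homMk ((hA.restrict h).restrict g) x hx
    let ν : G ⟶ FlowShape.map h ⋙ B := hG.homMk (hB.restrict h) y hy
    let πh : FlowShape.map h ⋙ A ⟶ FlowShape.map h ⋙ B := Functor.whiskerLeft _ π
    have : HasLiftingProperty l πh := hl _ <|
      (rlp_flowCells_iff i hQ (hB.restrict h) _).2 ⟨fun n a b => hπ n (h a) (h b), hA.restrict h⟩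
    have sq' : CommSq ((adj.homEquiv _ _).symm μ) l πh ν := ⟨by
      apply (adj.homEquiv _ _).injective
      rw [adj.homEquiv_naturality_right, adj.homEquiv_naturality_right, Equiv.apply_symm_apply]
      refine ((hB.restrict h).restrict g).hom_ext fun a b => ?_
      exact (Category.comp_id _).symm.trans (EnrSemicat.congr_map sq.w a b)⟩
    have fac : adj.homEquiv _ _ (l ≫ sq'.lift) = μ := by
      rw [sq'.fac_left, Equiv.apply_symm_apply]
    exact ⟨⟨⟨hG.hom hA h sq'.lift,
      EnrSemicat.hom_ext (fun _ => rfl) fun a b => (Category.comp_id _).trans <|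
        (hK.homOfLan_comp hG hA g h l sq'.lift a b).trans (NatTrans.congr_app fac (edge a b)),
      EnrSemicat.hom_ext (fun _ => rfl) fun a b => (Category.comp_id _).trans <|
        NatTrans.congr_app sq'.fac_right (edge a b)⟩⟩⟩

theorem hasLiftingProperty_homOfLan (hQ : Q.IsStrongGenerator) (hK : IsSegal K) (hG : IsSegal G)
    {g : R → S} (hg : Function.Injective g) {l : (FlowShape.map g).lan.obj K ⟶ G}
    (hl : (flowCells S Q i).rlp.llp l) {A B : EnrSemicat.{v} V} (p : A ⟶ B)
    (hp : Function.Surjective p.obj) (hpi : ∀ n a b, HasLiftingProperty (i n) (p.map a b)) :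
    HasLiftingProperty (hK.homOfLan hG g l) p := by
  obtain ⟨T, A, hA, rfl⟩ := A.exists_flow_eq
  obtain ⟨T', B, hB, rfl⟩ := B.exists_flow_eq
  let π : A ⟶ FlowShape.map p.obj ⋙ B := hA.homMk (hB.restrict p.obj) p.map p.map_comp
  have h₁ : HasLiftingProperty (hK.homOfLan hG g l) (hB.flow.toPull p) :=
    hasLiftingProperty_flowMap i hQ hK hG hA (hB.restrict p.obj) hl (π := π) hpi
  have h₂ : HasLiftingProperty (hK.homOfLan hG g l) (hB.flow.pullι p.obj) :=
    EnrSemicat.hasLiftingProperty_pullι hg hp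
  exact hB.flow.toPull_pullι p ▸ inferInstance

end IsSegal

theorem exists_factorization_isSegal {R T : Type v} {K : FlowShape R ⥤ V} {L : FlowShape T ⥤ V}
    [Small.{v} ι] [ObjectProperty.Small.{v} Q] (hQ : Q.IsStrongGenerator)
    (hK : IsSegal K) (hL : IsSegal L) (f : hK.flow ⟶ hL.flow) :
    ∃ (G : FlowShape (R ⊕ T) ⥤ V) (hG : IsSegal G) (l : (FlowShape.map Sum.inl).lan.obj K ⟶ G)
      (q : hG.flow ⟶ hL.flow), (flowCells _ Q i).rlp.llp l ∧ hK.homOfLan hG Sum.inl l ≫ q = f ∧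
        Function.Surjective q.obj ∧ ∀ n a b, HasLiftingProperty (i n) (q.map a b) := by
  let φ : R ⊕ T → T := Sum.elim f.obj id
  let adj := (FlowShape.map (Sum.inl : R → R ⊕ T)).lanAdjunction V
  let β : K ⟶ FlowShape.map Sum.inl ⋙ FlowShape.map φ ⋙ L :=
    hK.homMk ((hL.restrict φ).restrict Sum.inl) f.map f.map_comp
  have := hasFactorization_flowCells i Q (R ⊕ T)
  let D := MorphismProperty.factorizationData (flowCells (R ⊕ T) Q i).rlp.llp
    (flowCells (R ⊕ T) Q i).rlp ((adj.homEquiv _ _).symm β)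
  obtain ⟨hr, hG⟩ := (rlp_flowCells_iff i hQ (hL.restrict φ) D.p).1 D.hp
  refine ⟨D.Z, hG, D.i, hG.hom hL φ D.p, D.hi, EnrSemicat.hom_ext (fun _ => rfl) fun a b => ?_,
    fun y => ⟨Sum.inr y, rfl⟩, hr⟩
  have fac : adj.homEquiv _ _ (D.i ≫ D.p) = β := by rw [D.fac, Equiv.apply_symm_apply]
  exact (Category.comp_id _).trans ((hK.homOfLan_comp hG hL Sum.inl φ D.i D.p a b).trans
    (NatTrans.congr_app fac (edge a b)))

end Factorization

section WeakFactorizationSystem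

variable {V : Type u} [Category.{v} V] [CartesianMonoidalCategory V] [MonoidalClosed V]
  [IsLocallyPresentable.{v} V] {ι : Type*} [Small.{v} ι] {s d : ι → V} (i : ∀ n, s n ⟶ d n)

theorem isWeakFactorizationSystem_globGens :
    (globGens.{v} i).rlp.llp.IsWeakFactorizationSystem (globGens i).rlp where
  rlp := MorphismProperty.rlp_llp_rlp _
  llp := rfl
  hasFactorization := ⟨fun {X Y} f => by
    obtain ⟨Q, _, hQ⟩ := exists_small_isStrongGenerator V
    obtain ⟨R, K, hK, rfl⟩ := X.exists_flow_eq
    obtain ⟨T, L, hL, rfl⟩ := Y.exists_flow_eq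
    obtain ⟨G, hG, l, q, hl, fac, hq⟩ := exists_factorization_isSegal i hQ hK hL f
    exact ⟨⟨hG.flow, hK.homOfLan hG Sum.inl l, q, fac, fun _ _ p hp =>
      have ⟨hp, hpi⟩ := (rlp_globGens_iff i p).1 hp
      hK.hasLiftingProperty_homOfLan i hQ hG Sum.inl_injective hl p hp hpi,
      (rlp_globGens_iff i q).2 hq⟩⟩⟩

theorem isSmall_globGens : MorphismProperty.IsSmall.{v} (globGens.{w} i) := by
  unfold globGens
  infer_instance

end WeakFactorizationSystem

/-! ### Disks and spheres -/

section Spaces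

open TopCat

/-- The point of the boundary of the `1`-disk with coordinate `c`. -/
def diskBoundaryOnePoint (c : ℝ) (hc : |c| = 1) : (∂𝔻 1 : TopCat.{u}) :=
  ULift.up ⟨EuclideanSpace.single 0 c, by simp [hc]⟩

theorem diskBoundaryOnePoint_one_ne_neg_one :
    (diskBoundaryOnePoint 1 (by simp) : (∂𝔻 1 : TopCat.{u})) ≠
      diskBoundaryOnePoint (-1) (by simp) := by
  intro h
  have h' : EuclideanSpace.single (0 : Fin 1) (1 : ℝ) = EuclideanSpace.single 0 (-1) :=
    congrArg (fun x => x.down.1) h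
  have : (1 : ℝ) = -1 := by simpa using congrArg (fun x => x 0) h'
  norm_num at this

theorem eq_diskBoundaryOnePoint (x : (∂𝔻 1 : TopCat.{u})) :
    x = diskBoundaryOnePoint 1 (by simp) ∨ x = diskBoundaryOnePoint (-1) (by simp) := by
  obtain ⟨⟨x, hx⟩⟩ := x
  obtain ⟨c, rfl⟩ : ∃ c, x = EuclideanSpace.single 0 c :=
    ⟨x 0, by ext i; rw [Subsingleton.elim i 0]; simp⟩
  obtain rfl | rfl : c = 1 ∨ c = -1 := eq_or_eq_neg_of_abs_eq (by simpa using hx)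
  exacts [.inl rfl, .inr rfl]

instance discreteTopology_diskBoundary_one : DiscreteTopology (∂𝔻 1 : TopCat.{u}) := by
  have : Finite (∂𝔻 1 : TopCat.{u}) := Finite.of_finite_univ <|
    (Set.toFinite {diskBoundaryOnePoint 1 (by simp), diskBoundaryOnePoint (-1) (by simp)}).subset
      fun x _ => eq_diskBoundaryOnePoint x
  have : T1Space (∂𝔻 1 : TopCat.{u}) :=
    inferInstanceAs (T1Space (ULift (Metric.sphere (0 : EuclideanSpace ℝ (Fin 1)) 1)))
  infer_instance

instance connectedSpace_disk (n : ℕ) : ConnectedSpace (𝔻 n : TopCat.{u}) := by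
  have : ConnectedSpace (Metric.closedBall (0 : EuclideanSpace ℝ (Fin n)) 1) :=
    Subtype.connectedSpace ((convex_closedBall _ _).isConnected ⟨0, by simp⟩)
  exact Homeomorph.ulift.symm.surjective.connectedSpace Homeomorph.ulift.symm.continuous

end Spaces

section FullSubcategory

variable {P : ObjectProperty TopCat.{u}}

theorem fullSubcategory_hom_ext {T K : P.FullSubcategory} {f g : T ⟶ K}
    (h : ∀ x : T.obj, f.hom x = g.hom x) : f = g := by
  apply ObjectProperty.hom_ext
  ext x
  exact h x

/-- The constant map with value `k`. -/
def constHom (T : P.FullSubcategory) {K : P.FullSubcategory} (k : K.obj) : T ⟶ K :=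
  ObjectProperty.homMk (TopCat.ofHom (ContinuousMap.const _ k))

theorem nonempty_isInitial (K : P.FullSubcategory) [IsEmpty K.obj] : Nonempty (IsInitial K) :=
  ⟨IsInitial.ofUniqueHom (fun _ => ObjectProperty.homMk (TopCat.ofHom
    ⟨isEmptyElim, continuous_of_discreteTopology⟩)) fun _ _ =>
      fullSubcategory_hom_ext fun x => isEmptyElim x⟩

variable [CartesianMonoidalCategory P.FullSubcategory]

theorem subsingleton_tensorUnit : Subsingleton (𝟙_ P.FullSubcategory).obj where
  allEq x y := by
    have := toUnit_unique (constHom (𝟙_ P.FullSubcategory) x) (constHom (𝟙_ P.FullSubcategory) y)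
    exact congrArg (fun f : 𝟙_ P.FullSubcategory ⟶ 𝟙_ P.FullSubcategory => f.hom x) this

variable {E : P.FullSubcategory} {x y : E.obj} (hxy : x ≠ y) (hE : ∀ z, z = x ∨ z = y)

theorem constHom_tensorUnit_injective :
    Function.Injective (constHom (𝟙_ P.FullSubcategory) : E.obj → _) := fun x _ h =>
  congrArg (fun f : 𝟙_ P.FullSubcategory ⟶ E => f.hom ((toUnit E).hom x)) h

include hxy hE in
open Classical in
theorem nonempty_isColimit_binaryCofan [DiscreteTopology E.obj] : Nonempty (IsColimit
    (BinaryCofan.mk (constHom (𝟙_ P.FullSubcategory) x) (constHom (𝟙_ P.FullSubcategory) y))) := by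
  have := subsingleton_tensorUnit (P := P)
  let pt : (𝟙_ P.FullSubcategory).obj := (toUnit E).hom x
  let desc {T : P.FullSubcategory} (f g : 𝟙_ P.FullSubcategory ⟶ T) : E ⟶ T :=
    ObjectProperty.homMk (TopCat.ofHom
      ⟨fun z => if z = x then f.hom pt else g.hom pt, continuous_of_discreteTopology⟩)
  have desc_x {T : P.FullSubcategory} (f g : 𝟙_ P.FullSubcategory ⟶ T) :
      (desc f g).hom x = f.hom pt := if_pos rfl
  have desc_y {T : P.FullSubcategory} (f g : 𝟙_ P.FullSubcategory ⟶ T) :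
      (desc f g).hom y = g.hom pt := if_neg hxy.symm
  have comp_hom {T : P.FullSubcategory} (f : 𝟙_ P.FullSubcategory ⟶ T) (z) : f.hom z = f.hom pt :=
    congrArg f.hom (Subsingleton.elim z pt)
  refine ⟨BinaryCofan.IsColimit.mk _ (fun f g => desc f g)
    (fun f g => fullSubcategory_hom_ext fun z => (desc_x f g).trans (comp_hom f z).symm)
    (fun f g => fullSubcategory_hom_ext fun z => (desc_y f g).trans (comp_hom g z).symm)
    fun f g m hf hg => fullSubcategory_hom_ext fun z => ?_⟩
  subst hf hg
  rcases hE z with hz | hz <;> rw [hz]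
  exacts [(desc_x (constHom _ x ≫ m) (constHom _ y ≫ m)).symm,
    (desc_y (constHom _ x ≫ m) (constHom _ y ≫ m)).symm]

variable [HasBinaryCoproduct (𝟙_ P.FullSubcategory) (𝟙_ P.FullSubcategory)]

include hxy hE in
theorem exists_iso_coprod_tensorUnit [DiscreteTopology E.obj] :
    ∃ e : 𝟙_ P.FullSubcategory ⨿ 𝟙_ P.FullSubcategory ≅ E,
      coprod.inl ≫ e.hom = constHom _ x ∧ coprod.inr ≫ e.hom = constHom _ y := by
  obtain ⟨h⟩ := nonempty_isColimit_binaryCofan hxy hE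
  exact ⟨(coprodIsCoprod _ _).coconePointUniqueUpToIso h,
    (coprodIsCoprod _ _).comp_coconePointUniqueUpToIso_hom h ⟨.left⟩,
    (coprodIsCoprod _ _).comp_coconePointUniqueUpToIso_hom h ⟨.right⟩⟩

include hxy hE in
theorem hasEnoughPoints_fullSubcategory [DiscreteTopology E.obj] :
    HasEnoughPoints P.FullSubcategory where
  inl_ne_inr h := by
    obtain ⟨e, hx, hy⟩ := exists_iso_coprod_tensorUnit hxy hE
    exact hxy (constHom_tensorUnit_injective (hx.symm.trans ((h =≫ e.hom).trans hy)))
  nonempty_or_isInitial K := by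
    obtain _ | ⟨⟨k⟩⟩ := isEmpty_or_nonempty K.obj
    exacts [.inr (nonempty_isInitial K), .inl ⟨constHom _ k⟩]

include hxy hE in
theorem isConnectedObject_of_connectedSpace [DiscreteTopology E.obj] (D : P.FullSubcategory)
    [ConnectedSpace D.obj] : IsConnectedObject D where
  nonempty := ⟨constHom _ (Classical.arbitrary D.obj)⟩
  eq_inl_or_eq_inr c := by
    obtain ⟨e, hx, hy⟩ := exists_iso_coprod_tensorUnit hxy hE
    let t₀ : D.obj := Classical.arbitrary _
    have hc (t : D.obj) : (c ≫ e.hom).hom t = (c ≫ e.hom).hom t₀ :=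
      PreconnectedSpace.constant inferInstance (c ≫ e.hom).hom.hom.continuous
    rw [← cancel_mono e.hom, ← cancel_mono e.hom, Category.assoc, Category.assoc, hx, hy]
    exact (hE ((c ≫ e.hom).hom t₀)).imp (fun h => fullSubcategory_hom_ext fun t => (hc t).trans h)
      fun h => fullSubcategory_hom_ext fun t => (hc t).trans h

theorem hasEnoughPoints_of_diskBoundary (hS : P (TopCat.diskBoundary 1)) :
    HasEnoughPoints P.FullSubcategory :=
  hasEnoughPoints_fullSubcategory (E := ⟨_, hS⟩) diskBoundaryOnePoint_one_ne_neg_one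
    eq_diskBoundaryOnePoint

theorem isConnectedObject_disk (hS : P (TopCat.diskBoundary 1)) {n : ℕ} (hD : P (TopCat.disk n)) :
    IsConnectedObject (⟨_, hD⟩ : P.FullSubcategory) :=
  isConnectedObject_of_connectedSpace (E := ⟨_, hS⟩) diskBoundaryOnePoint_one_ne_neg_one
    eq_diskBoundaryOnePoint _

end FullSubcategory

end

theorem proposition3p2_general {V : Type u} [Category.{v} V] [CartesianMonoidalCategory V]
    [MonoidalClosed V] [IsLocallyPresentable.{v} V] (hV : HasEnoughPoints V) {ι : Type*}
    [Small.{v} ι] {s d : ι → V} (i : ∀ n, s n ⟶ d n) (hd : ∀ n, IsConnectedObject (d n)) :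
    MorphismProperty.IsSmall.{v} (globGens.{v} i) ∧
    IsLeftLifting (addId V) ((globGens.{v} i).strictMap (addId V)).rlp.llp
      (globGens.{v} i).rlp.llp (globGens.{v} i).rlp ∧
    ((globGens.{v} i).strictMap (addId V)).rlp.llp.inverseImage (addId V) =
      (globGens.{v} i).rlp.llp :=
  have h := inverseImage_addId_eq_llp_rlp i hV hd
  ⟨isSmall_globGens i, ⟨h.symm, isWeakFactorizationSystem_globGens i⟩, h⟩

theorem proposition3p2 (P : ObjectProperty TopCat.{u})
    [CartesianMonoidalCategory P.FullSubcategory] [MonoidalClosed P.FullSubcategory]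
    [IsLocallyPresentable.{u} P.FullSubcategory]
    (hS : ∀ n, P (TopCat.diskBoundary n)) (hD : ∀ n, P (TopCat.disk n)) :
    MorphismProperty.IsSmall.{u} (IglC P hS hD) ∧
    IsLeftLifting (addId P.FullSubcategory) (iliasCof P hS hD)
      (IglC P hS hD).rlp.llp (IglC P hS hD).rlp ∧
    (iliasCof P hS hD).inverseImage (addId P.FullSubcategory) = (IglC P hS hD).rlp.llp :=
  proposition3p2_general (hasEnoughPoints_of_diskBoundary (hS 1)) (sphereIncl P hS hD) fun n =>
    isConnectedObject_disk (hS 1) (hD n)
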